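/- Let $m,n\ge 0$ be integers, ${\bf I}=\{1,\dots,m+n\}$, ${\bf I}'=\{1,\dots,m+n-1\}$, let $q$ be a positive real number with $q\neq 1$, and put $[a]=0$ for $a\le m$, $[a]=1$ for $a>m$, $q_a=q^{(-1)^{[a]}}$. Let $U_q(gl(m|n))$ be the quantum superalgebra (Jimbo form, over $\mathbb C$, at this value of $q$): the unital associative $\mathbb C$-algebra generated by $K_a^{\pm1}$ ($a\in{\bf I}$), $E_{b,b+1}$, $E_{b+1,b}$ ($b\in{\bf I}'$), where $E_{m,m+1}$, $E_{m+1,m}$ are odd and all other generators are even, subject to - $K_aK_a^{-1}=K_a^{-1}K_a=1$, $K_a^{\pm1}K_b^{\pm1}=K_b^{\pm1}K_a^{\pm1}$, $K_aE_{b,b\pm1}K_a^{-1}=q_a^{\delta_{a,b}-\delta_{a,b\pm1}}E_{b,b\pm1}$; - $E_{a,a+1}E_{b+1,b}-\varepsilon_{ab}E_{b+1,b}E_{a,a+1}=\delta_{ab}(K_aK_{a+1}^{-1}-K_a^{-1}K_{a+1})/(q_a-q_a^{-1})$, where $\varepsilon_{ab}=-1$ if $a=b=m$ and $\varepsilon_{ab}=1$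 otherwise; - $E_{m,m+1}^2=E_{m+1,m}^2=0$; and $E_{a,a+1}E_{b,b+1}=E_{b,b+1}E_{a,a+1}$, $E_{a+1,a}E_{b+1,b}=E_{b+1,b}E_{a+1,a}$ for $|a-b|\ge2$; - $x^2y-(q+q^{-1})xyx+yx^2=0$ for $(x,y)=(E_{a,a+1},E_{b,b+1})$ and $(x,y)=(E_{a+1,a},E_{b+1,b})$ whenever $|a-b|=1$, $a\ne m$; - $E_{m-1,m+2}E_{m,m+1}+E_{m,m+1}E_{m-1,m+2}=0$ and $E_{m+2,m-1}E_{m+1,m}+E_{m+1,m}E_{m+2,m-1}=0$ (for $m,n\ge2$), where $E_{a,b}=E_{a,c}E_{c,b}-q_c^{-1}E_{c,b}E_{a,c}$ and $E_{b,a}=E_{b,c}E_{c,a}-q_cE_{c,a}E_{b,c}$ for $a<c<b$. Fix a subset $\Theta\subseteq{\bf I}'$. Let $U_q(\mathfrak l)$ be the subalgebra generated by all $K_a^{\pm1}$ and by $E_{c,c+1},E_{c+1,c}$ with $c\in\Theta$, and let $U_q(\mathfrak p_+)$ (resp. $U_q(\mathfrak p_-)$) be the subalgebra generated by $U_q(\mathfrak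 l)$ and the $E_{c,c+1}$ (resp. $E_{c+1,c}$) with $c\in{\bf I}'\setminus\Theta$. All modules are $\mathbb Z_2$-graded, and irreducible means non-zero without proper non-zero graded submodules. A vector has weight $\nu=(\nu_b)_{b\in{\bf I}}\in\mathbb C^{m+n}$ if every $K_b$ acts on it by $q_b^{\nu_b}$; accordingly, equality of weights is understood componentwise modulo $(2\pi i/\log q)\mathbb Z$. Let $W(\lambda)$ be a finite-dimensional irreducible $U_q(gl(m|n))$-module with highest weight $\lambda$ and lowest weight $\bar\lambda$ (the weights of non-zero weight vectors killed by all $E_{a,a+1}$, respectively by all $E_{a+1,a}$, $a\in{\bf I}'$). Let $V_\mu$ be a finite-dimensional irreducible $U_q(\mathfrak l)$-module with highest weight $\mu$ and lowest weight $\tilde\mu$ (defined in the same way with $a\in\Theta$), extended to a $U_q(\mathfrak p_+)$-module (resp. $U_q(\mathfrak p_-)$-module) on which the $E_{c,c+1}$ (resp. $E_{c+1,c}$), $c\in{\bf I}'\setminus\Theta$, act by zero. For $\mathfrak p=\mathfrak p_\pm$ let $\mathrm{Hom}_{U_q(\mathfrak p)}(W(\lambda),V_\mu)$ be the $\mathbb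 Z_2$-graded space spanned by the homogeneous linear maps $\phi$, even or odd, with $p\,\phi=(-1)^{[p][\phi]}\phi\,p$ for all homogeneous $p\in U_q(\mathfrak p)$. Then $$\dim_{\mathbb C}\mathrm{Hom}_{U_q(\mathfrak p_+)}(W(\lambda),V_\mu)=\begin{cases}1,&\bar\lambda=\tilde\mu,\\0,&\bar\lambda\ne\tilde\mu,\end{cases}\qquad \dim_{\mathbb C}\mathrm{Hom}_{U_q(\mathfrak p_-)}(W(\lambda),V_\mu)=\begin{cases}1,&\lambda=\mu,\\0,&\lambda\ne\mu.\end{cases}$$ -/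

import Mathlib

open scoped DirectSum

noncomputable section

namespace QuantumGL

/-! ### The quantum superalgebra `U_q(gl(m|n))`

The index set `{1, …, m+n}` is modelled by `Fin (m + n)` (shifted by one), and the set
`{1, …, m+n-1}` of simple roots by `Fin (m + n - 1)`: the node `i` joins the indices `i` and `i + 1`.
-/

/-- The index `i` (left end of the node `i`). -/
def lft {m n : ℕ} (i : Fin (m + n - 1)) : Fin (m + n) := ⟨i.1, by omega⟩

/-- The index `i + 1` (right end of the node `i`). -/
def rgt {m n : ℕ} (i : Fin (m + n - 1)) : Fin (m + n) := ⟨i.1 + 1, by omega⟩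

/-- `q_a = q ^ ((-1) ^ [a])`, where `[a] = 0` for the first `m` indices and `[a] = 1` for the
others. -/
def qAt (m n : ℕ) (q : ℝ) (a : Fin (m + n)) : ℝ := if a.1 < m then q else q⁻¹

/-- The generators: `K a`, `Kinv a` stand for `K_a`, `K_a⁻¹`, and `E i`, `F i` for
`E_{i, i+1}`, `E_{i+1, i}`. -/
inductive Gen (m n : ℕ) : Type
  | K (a : Fin (m + n))
  | Kinv (a : Fin (m + n))
  | E (i : Fin (m + n - 1))
  | F (i : Fin (m + n - 1))

/-- The parity of a node: only the node joining the `m`-th and the `(m+1)`-st index is odd. -/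
def nodeParity {m n : ℕ} (i : Fin (m + n - 1)) : ZMod 2 := if i.1 + 1 = m then 1 else 0

/-- The parity of a generator. -/
def Gen.parity {m n : ℕ} : Gen m n → ZMod 2
  | .K _ => 0
  | .Kinv _ => 0
  | .E i => nodeParity i
  | .F i => nodeParity i

/-- The sign `(-1) ^ θ` of a parity `θ`. -/
def sgn (θ : ZMod 2) : ℂ := (-1) ^ θ.val

section Relations

variable {m n : ℕ}

/-- The free generators. -/
abbrev fK (a : Fin (m + n)) : FreeAlgebra ℂ (Gen m n) := FreeAlgebra.ι ℂ (Gen.K a)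
/-- The free generators. -/
abbrev fKinv (a : Fin (m + n)) : FreeAlgebra ℂ (Gen m n) := FreeAlgebra.ι ℂ (Gen.Kinv a)
/-- The free generators. -/
abbrev fE (i : Fin (m + n - 1)) : FreeAlgebra ℂ (Gen m n) := FreeAlgebra.ι ℂ (Gen.E i)
/-- The free generators. -/
abbrev fF (i : Fin (m + n - 1)) : FreeAlgebra ℂ (Gen m n) := FreeAlgebra.ι ℂ (Gen.F i)

/-- `x² y - (q + q⁻¹) x y x + y x²`. -/
def serre (q : ℝ) (x y : FreeAlgebra ℂ (Gen m n)) : FreeAlgebra ℂ (Gen m n) :=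
  x ^ 2 * y - ((q : ℂ) + (q : ℂ)⁻¹) • (x * y * x) + y * x ^ 2

/-- `x y - c y x`. -/
def qComm (c : ℝ) (x y : FreeAlgebra ℂ (Gen m n)) : FreeAlgebra ℂ (Gen m n) :=
  x * y - (c : ℂ) • (y * x)

/-- The integer `δ_{a, i} - δ_{a, i+1}`. -/
def rootCoeff (a : Fin (m + n)) (i : Fin (m + n - 1)) : ℤ :=
  (if a = lft i then 1 else 0) - (if a = rgt i then 1 else 0)

variable (m n)

/-- The defining relations of `U_q(gl(m|n))`. -/
inductive Rel (q : ℝ) : FreeAlgebra ℂ (Gen m n) → FreeAlgebra ℂ (Gen m n) → Prop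
  | K_Kinv (a : Fin (m + n)) : Rel q (fK a * fKinv a) 1
  | Kinv_K (a : Fin (m + n)) : Rel q (fKinv a * fK a) 1
  | K_K (a b : Fin (m + n)) : Rel q (fK a * fK b) (fK b * fK a)
  | K_Kinv_comm (a b : Fin (m + n)) : Rel q (fK a * fKinv b) (fKinv b * fK a)
  | Kinv_Kinv (a b : Fin (m + n)) : Rel q (fKinv a * fKinv b) (fKinv b * fKinv a)
  | K_E (a : Fin (m + n)) (i : Fin (m + n - 1)) :
      Rel q (fK a * fE i * fKinv a) (((qAt m n q a : ℂ) ^ rootCoeff a i) • fE i)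
  | K_F (a : Fin (m + n)) (i : Fin (m + n - 1)) :
      Rel q (fK a * fF i * fKinv a) (((qAt m n q a : ℂ) ^ (-rootCoeff a i)) • fF i)
  | E_F_same (i : Fin (m + n - 1)) :
      Rel q (fE i * fF i - sgn (nodeParity i * nodeParity i) • (fF i * fE i))
        (((qAt m n q (lft i) : ℂ) - (qAt m n q (lft i) : ℂ)⁻¹)⁻¹ •
          (fK (lft i) * fKinv (rgt i) - fKinv (lft i) * fK (rgt i)))
  | E_F_ne (i j : Fin (m + n - 1)) (h : i ≠ j) :
      Rel q (fE i * fF j - sgn (nodeParity i * nodeParity j) • (fF j * fE i)) 0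
  | E_sq (i : Fin (m + n - 1)) (h : i.1 + 1 = m) : Rel q (fE i ^ 2) 0
  | F_sq (i : Fin (m + n - 1)) (h : i.1 + 1 = m) : Rel q (fF i ^ 2) 0
  | E_far (i j : Fin (m + n - 1)) (h : i.1 + 2 ≤ j.1 ∨ j.1 + 2 ≤ i.1) :
      Rel q (fE i * fE j) (fE j * fE i)
  | F_far (i j : Fin (m + n - 1)) (h : i.1 + 2 ≤ j.1 ∨ j.1 + 2 ≤ i.1) :
      Rel q (fF i * fF j) (fF j * fF i)
  | E_serre (i j : Fin (m + n - 1)) (hi : i.1 + 1 ≠ m) (h : i.1 + 1 = j.1 ∨ j.1 + 1 = i.1) :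
      Rel q (serre q (fE i) (fE j)) 0
  | F_serre (i j : Fin (m + n - 1)) (hi : i.1 + 1 ≠ m) (h : i.1 + 1 = j.1 ∨ j.1 + 1 = i.1) :
      Rel q (serre q (fF i) (fF j)) 0
  /-- `{E_{m-1, m+2}, E_{m, m+1}} = 0`, where
  `E_{m-1, m+1} = E_{m-1, m} E_{m, m+1} - q_m⁻¹ E_{m, m+1} E_{m-1, m}` and
  `E_{m-1, m+2} = E_{m-1, m+1} E_{m+1, m+2} - q_{m+1}⁻¹ E_{m+1, m+2} E_{m-1, m+1}`. -/
  | E_quartic (i j k : Fin (m + n - 1)) (hj : j.1 + 1 = m) (hi : i.1 + 1 = j.1)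
      (hk : j.1 + 1 = k.1) :
      Rel q
        (qComm (qAt m n q (rgt j))⁻¹ (qComm (qAt m n q (lft j))⁻¹ (fE i) (fE j)) (fE k) * fE j
          + fE j *
            qComm (qAt m n q (rgt j))⁻¹ (qComm (qAt m n q (lft j))⁻¹ (fE i) (fE j)) (fE k))
        0
  /-- `{E_{m+2, m-1}, E_{m+1, m}} = 0`, where
  `E_{m+1, m-1} = E_{m+1, m} E_{m, m-1} - q_m E_{m, m-1} E_{m+1, m}` and
  `E_{m+2, m-1} = E_{m+2, m+1} E_{m+1, m-1} - q_{m+1} E_{m+1, m-1} E_{m+2, m+1}`. -/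
  | F_quartic (i j k : Fin (m + n - 1)) (hj : j.1 + 1 = m) (hi : i.1 + 1 = j.1)
      (hk : j.1 + 1 = k.1) :
      Rel q
        (qComm (qAt m n q (rgt j)) (fF k) (qComm (qAt m n q (lft j)) (fF j) (fF i)) * fF j
          + fF j *
            qComm (qAt m n q (rgt j)) (fF k) (qComm (qAt m n q (lft j)) (fF j) (fF i)))
        0

end Relations

/-- The algebra `U_q(gl(m|n))` over `ℂ`, at a real parameter `q`. -/
abbrev Uq (m n : ℕ) (q : ℝ) : Type := RingQuot (Rel m n q)

section Algebra

variable {m n : ℕ} {q : ℝ}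

/-- The image of a generator in `U_q(gl(m|n))`. -/
def gen (g : Gen m n) : Uq m n q := RingQuot.mkAlgHom ℂ (Rel m n q) (FreeAlgebra.ι ℂ g)

variable (m n q)

/-- The `ℤ/2`-grading of `U_q(gl(m|n))`: the part of parity `θ` is spanned by the monomials in
the generators whose total parity is `θ`. -/
def parityPart (θ : ZMod 2) : Submodule ℂ (Uq m n q) :=
  Submodule.span ℂ
    {x | ∃ l : List (Gen m n), (l.map Gen.parity).sum = θ ∧ x = (l.map gen).prod}

variable {m n}

/-- The generators `K_a^{±1}`, and `E_{c, c+1}`, `E_{c+1, c}` for `c ∈ Θ`. -/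
def leviGens (Θ : Set (Fin (m + n - 1))) : Set (Uq m n q) :=
  {x | (∃ a, x = gen (.K a)) ∨ (∃ a, x = gen (.Kinv a)) ∨
    (∃ c ∈ Θ, x = gen (.E c)) ∨ (∃ c ∈ Θ, x = gen (.F c))}

/-- The subalgebra `U_q(l)`. -/
def levi (Θ : Set (Fin (m + n - 1))) : Subalgebra ℂ (Uq m n q) :=
  Algebra.adjoin ℂ (leviGens q Θ)

/-- The parabolic subalgebra `U_q(p_+)`. -/
def parabolicPos (Θ : Set (Fin (m + n - 1))) : Subalgebra ℂ (Uq m n q) :=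
  Algebra.adjoin ℂ (leviGens q Θ ∪ {x | ∃ c ∉ Θ, x = gen (.E c)})

/-- The parabolic subalgebra `U_q(p_-)`. -/
def parabolicNeg (Θ : Set (Fin (m + n - 1))) : Subalgebra ℂ (Uq m n q) :=
  Algebra.adjoin ℂ (leviGens q Θ ∪ {x | ∃ c ∉ Θ, x = gen (.F c)})

variable (Θ : Set (Fin (m + n - 1)))

theorem levi_le_pos : levi q Θ ≤ parabolicPos q Θ :=
  Algebra.adjoin_mono Set.subset_union_left

theorem levi_le_neg : levi q Θ ≤ parabolicNeg q Θ :=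
  Algebra.adjoin_mono Set.subset_union_left

theorem K_mem_levi (a : Fin (m + n)) : gen (.K a) ∈ levi q Θ :=
  Algebra.subset_adjoin (Or.inl ⟨a, rfl⟩)

theorem E_mem_levi {c : Fin (m + n - 1)} (hc : c ∈ Θ) : gen (.E c) ∈ levi q Θ :=
  Algebra.subset_adjoin (Or.inr (Or.inr (Or.inl ⟨c, hc, rfl⟩)))

theorem F_mem_levi {c : Fin (m + n - 1)} (hc : c ∈ Θ) : gen (.F c) ∈ levi q Θ :=
  Algebra.subset_adjoin (Or.inr (Or.inr (Or.inr ⟨c, hc, rfl⟩)))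

theorem E_mem_pos {c : Fin (m + n - 1)} (hc : c ∉ Θ) : gen (.E c) ∈ parabolicPos q Θ :=
  Algebra.subset_adjoin (Or.inr ⟨c, hc, rfl⟩)

theorem F_mem_neg {c : Fin (m + n - 1)} (hc : c ∉ Θ) : gen (.F c) ∈ parabolicNeg q Θ :=
  Algebra.subset_adjoin (Or.inr ⟨c, hc, rfl⟩)

variable {q}

/-- The `ℤ/2`-grading that a subalgebra generated by homogeneous elements inherits. -/
def subParity (B : Subalgebra ℂ (Uq m n q)) (θ : ZMod 2) : Submodule ℂ B :=
  (parityPart m n q θ).comap B.val.toLinearMap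

end Algebra

/-! ### Graded modules and graded homomorphisms -/

section Modules

variable {A : Type*} [Semiring A] [Algebra ℂ A] (𝒜 : ZMod 2 → Submodule ℂ A)
variable {W : Type*} [AddCommGroup W] [Module ℂ W] (𝒲 : ZMod 2 → Submodule ℂ W)
variable {V : Type*} [AddCommGroup V] [Module ℂ V] (𝒱 : ZMod 2 → Submodule ℂ V)

/-- The representation `ρ` makes `W = 𝒲 0 ⊕ 𝒲 1` a `ℤ/2`-graded module. -/
structure IsSuperModule (ρ : A →ₐ[ℂ] Module.End ℂ W) : Prop where
  isInternal : DirectSum.IsInternal 𝒲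
  map_mem : ∀ (i j : ZMod 2) (a : A) (w : W), a ∈ 𝒜 i → w ∈ 𝒲 j → ρ a w ∈ 𝒲 (i + j)

/-- `W = 𝒲 0 ⊕ 𝒲 1` is an irreducible `ℤ/2`-graded module: it is non-zero and its only graded
submodules are `0` and `W`. -/
structure IsIrreducibleSuperModule (ρ : A →ₐ[ℂ] Module.End ℂ W) : Prop
    extends IsSuperModule 𝒜 𝒲 ρ where
  nontrivial : Nontrivial W
  eq_bot_or_eq_top : ∀ N : Submodule ℂ W, N = (N ⊓ 𝒲 0) ⊔ (N ⊓ 𝒲 1) →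
    (∀ (a : A), ∀ w ∈ N, ρ a w ∈ N) → N = ⊥ ∨ N = ⊤

/-- The space of homogeneous homomorphisms of degree `θ`: the linear maps `φ` of degree `θ` with
`a φ = (-1) ^ ([a] θ) φ a` for all homogeneous `a`. -/
def homDeg (ρ : A →ₐ[ℂ] Module.End ℂ W) (τ : A →ₐ[ℂ] Module.End ℂ V) (θ : ZMod 2) :
    Submodule ℂ (W →ₗ[ℂ] V) where
  carrier := {φ | (∀ (j : ZMod 2), ∀ w ∈ 𝒲 j, φ w ∈ 𝒱 (j + θ)) ∧
    ∀ (i : ZMod 2), ∀ a ∈ 𝒜 i, ∀ w, τ a (φ w) = sgn (i * θ) • φ (ρ a w)}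
  add_mem' := by
    rintro φ ψ ⟨h1, h2⟩ ⟨k1, k2⟩
    refine ⟨fun j w hw => add_mem (h1 j w hw) (k1 j w hw), fun i a ha w => ?_⟩
    simp [h2 i a ha w, k2 i a ha w]
  zero_mem' := by simp
  smul_mem' := by
    rintro c φ ⟨h1, h2⟩
    refine ⟨fun j w hw => Submodule.smul_mem _ c (h1 j w hw), fun i a ha w => ?_⟩
    simp [h2 i a ha w, smul_comm c]

/-- The `ℤ/2`-graded space of homomorphisms, the sum of its even and its odd part. -/
def superHom (ρ : A →ₐ[ℂ] Module.End ℂ W) (τ : A →ₐ[ℂ] Module.End ℂ V) :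
    Submodule ℂ (W →ₗ[ℂ] V) :=
  homDeg 𝒜 𝒲 𝒱 ρ τ 0 ⊔ homDeg 𝒜 𝒲 𝒱 ρ τ 1

end Modules

/-! ### Weights -/

section Weights

variable {m n : ℕ} {q : ℝ}
variable {W : Type*} [AddCommGroup W] [Module ℂ W]

/-- Two tuples of complex numbers are the same weight: as `K_b` acts on a vector of weight `lam`
by `q_b ^ lam_b`, components matter only modulo the period `2πi / log q` of `z ↦ q ^ z`. -/
def SameWeight (q : ℝ) (lam mu : Fin (m + n) → ℂ) : Prop :=
  ∀ b, ∃ k : ℤ, lam b = mu b + k * (2 * Real.pi * Complex.I / Real.log q)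

/-- `lam` is a highest weight of the `U_q(gl(m|n))`-module `W`. -/
def IsHighestWeight (ρ : Uq m n q →ₐ[ℂ] Module.End ℂ W) (lam : Fin (m + n) → ℂ) : Prop :=
  ∃ v : W, v ≠ 0 ∧ (∀ i, ρ (gen (.E i)) v = 0) ∧
    ∀ b, ρ (gen (.K b)) v = ((qAt m n q b : ℂ) ^ lam b) • v

/-- `lam` is a lowest weight of the `U_q(gl(m|n))`-module `W`. -/
def IsLowestWeight (ρ : Uq m n q →ₐ[ℂ] Module.End ℂ W) (lam : Fin (m + n) → ℂ) : Prop :=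
  ∃ v : W, v ≠ 0 ∧ (∀ i, ρ (gen (.F i)) v = 0) ∧
    ∀ b, ρ (gen (.K b)) v = ((qAt m n q b : ℂ) ^ lam b) • v

variable (Θ : Set (Fin (m + n - 1)))

/-- `mu` is a highest weight of the `U_q(l)`-module `W`. -/
def IsLeviHighestWeight (σ : levi q Θ →ₐ[ℂ] Module.End ℂ W) (mu : Fin (m + n) → ℂ) : Prop :=
  ∃ v : W, v ≠ 0 ∧ (∀ c, ∀ hc : c ∈ Θ, σ ⟨gen (.E c), E_mem_levi q Θ hc⟩ v = 0) ∧
    ∀ b, σ ⟨gen (.K b), K_mem_levi q Θ b⟩ v = ((qAt m n q b : ℂ) ^ mu b) • v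

/-- `mu` is a lowest weight of the `U_q(l)`-module `W`. -/
def IsLeviLowestWeight (σ : levi q Θ →ₐ[ℂ] Module.End ℂ W) (mu : Fin (m + n) → ℂ) : Prop :=
  ∃ v : W, v ≠ 0 ∧ (∀ c, ∀ hc : c ∈ Θ, σ ⟨gen (.F c), F_mem_levi q Θ hc⟩ v = 0) ∧
    ∀ b, σ ⟨gen (.K b), K_mem_levi q Θ b⟩ v = ((qAt m n q b : ℂ) ^ mu b) • v

/-- The representation `τ` of `U_q(p_+)` extends the representation `σ` of `U_q(l)`, with
`E_{c, c+1}`, `c ∉ Θ`, acting by zero. -/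
def IsPosExtension (σ : levi q Θ →ₐ[ℂ] Module.End ℂ W)
    (τ : parabolicPos q Θ →ₐ[ℂ] Module.End ℂ W) : Prop :=
  τ.comp (Subalgebra.inclusion (levi_le_pos q Θ)) = σ ∧
    ∀ c, ∀ hc : c ∉ Θ, τ ⟨gen (.E c), E_mem_pos q Θ hc⟩ = 0

/-- The representation `τ` of `U_q(p_-)` extends the representation `σ` of `U_q(l)`, with
`E_{c+1, c}`, `c ∉ Θ`, acting by zero. -/
def IsNegExtension (σ : levi q Θ →ₐ[ℂ] Module.End ℂ W)
    (τ : parabolicNeg q Θ →ₐ[ℂ] Module.End ℂ W) : Prop :=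
  τ.comp (Subalgebra.inclusion (levi_le_neg q Θ)) = σ ∧
    ∀ c, ∀ hc : c ∉ Θ, τ ⟨gen (.F c), F_mem_neg q Θ hc⟩ = 0

end Weights

end QuantumGL

end

/-!
Both assertions are instances of one statement about a parabolic subalgebra containing one kind of
root vectors ("lowering") for all nodes and the other kind ("raising") for the nodes in `Θ` only;
exchanging `E_{i, i+1}` and `E_{i+1, i}` passes from `p_-` and highest weights to `p_+` and lowest
weights. The vector `v` below is the highest (respectively lowest) weight vector of `W`, and `u`
that of `V`.

On weight vectors, raising operators commute with lowering operators up to a sign and an added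
scalar, so the span of the vectors lowered from a highest weight vector is stable under both
(`IsTriangular.e_mem_lowerSpan`). Hence
`W` is generated by `v` under lowering operators alone, and a homomorphism `φ : W → V` is determined
by `φ v`, a highest weight vector of `V`. As `q` is not a root of unity, a non-empty sum of simple
roots is a non-trivial weight; hence the highest weight vectors of the irreducible module `V` form
the line through `u` (`IsTriangular.highest_unique`). This gives dimension at most one, and zero
unless the weights agree.

If the weights agree, the submodule of `W × V` generated by `(v, u)` is the graph of a homomorphism
(`IsTriangular.exists_intertwiner`): the `y` with `(0, y)` in it form a submodule of `V`, which does
not contain `u` because the weight space of `(v, u)` is a line. The lowering operators outside `Θ`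
act on `V` by zero, so irreducibility over the Levi subalgebra is enough for this argument. No
Poincaré–Birkhoff–Witt theorem and no Serre relation is used.

The grading enters through the parity operator, which is treated as one more commuting Cartan
operator (`IsSuperTriangular.adjoin_parityOp`). An odd homomorphism obeying the sign rule is an odd
linear map commuting with all operators, composed with the parity operator of `W`. Even and odd
homomorphisms cannot coexist, as they send `v` to components of different parity, and `u` may be
taken homogeneous.
-/

namespace QuantumGL

/-! ### Operators of triangular type -/

section Triangular

open Module.End

variable {I J : Type*} {W V : Type*} [AddCommGroup W] [Module ℂ W] [AddCommGroup V] [Module ℂ V]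

/-- Commuting operators `k`, lowering operators `f` and, for the nodes in `Θ`, raising operators
`e`, with the commutation rules of a quantised parabolic. The structure constants `s`, `ε`, `c` are
parameters, so that two modules can be required to obey the same rules; the commutator of `e i` and
`f j` is only prescribed on joint eigenvectors of `k`, where it is a scalar depending on the
eigenvalues. No relation between `k` and `e` is needed. -/
structure IsTriangular (Θ : Set J) (s : I → J → ℂ) (ε : J → J → ℂ) (c : J → J → (I → ℂ) → ℂ)
    (k : I → Module.End ℂ W) (e f : J → Module.End ℂ W) : Prop where
  comm : ∀ a b, Commute (k a) (k b)
  k_f : ∀ b j w, k b (f j w) = s b j • f j (k b w)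
  e_f : ∀ i ∈ Θ, ∀ j χ w, (∀ b, k b w = χ b • w) →
    e i (f j w) = ε i j • f j (e i w) + c i j χ • w

/-- The vector `v` is a joint eigenvector of `k` with eigenvalues `χ`, killed by the raising
operators `e i`, `i ∈ Θ`. The zero vector is allowed. -/
structure IsHighest (Θ : Set J) (k : I → Module.End ℂ W) (e : J → Module.End ℂ W) (χ : I → ℂ)
    (v : W) : Prop where
  k_eq : ∀ b, k b v = χ b • v
  e_eq : ∀ i ∈ Θ, e i v = 0

/-- There is no proper non-zero subspace stable under all `k b` and under `e i`, `f i` for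
`i ∈ Θ`. -/
def IsIrred (Θ : Set J) (k : I → Module.End ℂ W) (e f : J → Module.End ℂ W) : Prop :=
  ∀ N : Submodule ℂ W, (∀ b, ∀ w ∈ N, k b w ∈ N) → (∀ i ∈ Θ, ∀ w ∈ N, e i w ∈ N) →
    (∀ i ∈ Θ, ∀ w ∈ N, f i w ∈ N) → N = ⊥ ∨ N = ⊤

/-- The vector obtained from `v` by applying the lowering operators listed in `l`. -/
def lower (f : J → Module.End ℂ W) (l : List J) (v : W) : W := (l.map f).prod v

/-- The span of all vectors obtained from `v` by applying lowering operators. -/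
def lowerSpan (f : J → Module.End ℂ W) (v : W) : Submodule ℂ W :=
  Submodule.span ℂ (Set.range fun l => lower f l v)

@[simp] theorem lower_nil (f : J → Module.End ℂ W) (v : W) : lower f [] v = v := by
  simp [lower]

@[simp] theorem lower_cons (f : J → Module.End ℂ W) (j : J) (l : List J) (v : W) :
    lower f (j :: l) v = f j (lower f l v) := by
  simp [lower]

theorem lower_mem_lowerSpan (f : J → Module.End ℂ W) (l : List J) (v : W) :
    lower f l v ∈ lowerSpan f v := Submodule.subset_span ⟨l, rfl⟩

theorem mem_lowerSpan_self (f : J → Module.End ℂ W) (v : W) : v ∈ lowerSpan f v := by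
  simpa using lower_mem_lowerSpan f [] v

theorem map_mem_of_mem_lowerSpan {f : J → Module.End ℂ W} {v : W} (T : W →ₗ[ℂ] V)
    {N : Submodule ℂ V} (h : ∀ l, T (lower f l v) ∈ N) {w : W} (hw : w ∈ lowerSpan f v) :
    T w ∈ N := by
  have : lowerSpan f v ≤ N.comap T := Submodule.span_le.2 (by rintro _ ⟨l, rfl⟩; exact h l)
  exact this hw

theorem map_mem_lowerSpan (f : J → Module.End ℂ W) (v : W) (j : J) {w : W}
    (hw : w ∈ lowerSpan f v) : f j w ∈ lowerSpan f v :=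
  map_mem_of_mem_lowerSpan (f j)
    (fun l => by simpa using lower_mem_lowerSpan f (j :: l) v) hw

/-- A non-zero joint eigenvector in the span of a family of joint eigenvectors has the same
eigenvalues as one of the members. -/
theorem exists_eigenvalues_eq_of_mem_span {k : I → Module.End ℂ W}
    (comm : ∀ a b, Commute (k a) (k b)) {L : Type*} (x : L → W) (χ : L → I → ℂ)
    (hx : ∀ l b, k b (x l) = χ l b • x l) {y : W} {ψ : I → ℂ} (hy : ∀ b, k b y = ψ b • y)
    (hmem : y ∈ Submodule.span ℂ (Set.range x)) (h0 : y ≠ 0) : ∃ l, χ l = ψ := by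
  by_contra! hne
  have hind := independent_iInf_maxGenEigenspace_of_forall_mapsTo k
    fun i j φ => mapsTo_maxGenEigenspace_of_comm (comm j i) φ
  have key : ∀ (z : W) (χ : I → ℂ), (∀ b, k b z = χ b • z) →
      z ∈ ⨅ i, (k i).maxGenEigenspace (χ i) := by
    intro z χ hz
    rw [mem_iInf_maxGenEigenspace_iff]
    exact fun j => ⟨1, by simp [hz]⟩
  refine h0 ((Submodule.disjoint_def.1 (hind ψ)) y (key y ψ hy) ?_)
  refine Submodule.span_le.2 ?_ hmem
  rintro _ ⟨l, rfl⟩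
  exact Submodule.mem_iSup_of_mem (χ l) (Submodule.mem_iSup_of_mem (hne l) (key _ _ (hx l)))

namespace IsTriangular

variable {Θ : Set J} {s : I → J → ℂ} {ε : J → J → ℂ} {c : J → J → (I → ℂ) → ℂ}
  {k : I → Module.End ℂ W} {e f : J → Module.End ℂ W}
  {k' : I → Module.End ℂ V} {e' f' : J → Module.End ℂ V} {χ ψ : I → ℂ}

theorem k_lower (h : IsTriangular Θ s ε c k e f) {v : W} (hv : ∀ b, k b v = χ b • v)
    (l : List J) (b : I) : k b (lower f l v) = (χ b * (l.map (s b)).prod) • lower f l v := by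
  induction l with
  | nil => simp [hv]
  | cons j l ih =>
    simp only [lower_cons, h.k_f, ih, map_smul, smul_smul, List.map_cons, List.prod_cons]
    congr 1
    ring

theorem k_mem_lowerSpan (h : IsTriangular Θ s ε c k e f) {v : W} (hv : ∀ b, k b v = χ b • v)
    (b : I) {w : W} (hw : w ∈ lowerSpan f v) : k b w ∈ lowerSpan f v :=
  map_mem_of_mem_lowerSpan (k b) (fun l => by
    rw [h.k_lower hv]
    exact Submodule.smul_mem _ _ (lower_mem_lowerSpan f l v)) hw

/-- The form in which the triangular decomposition is used: raising operators do not lead out of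
the span of the vectors lowered from a highest weight vector. -/
theorem e_mem_lowerSpan (h : IsTriangular Θ s ε c k e f) {v : W} (hv : IsHighest Θ k e χ v)
    {i : J} (hi : i ∈ Θ) {w : W} (hw : w ∈ lowerSpan f v) : e i w ∈ lowerSpan f v := by
  refine map_mem_of_mem_lowerSpan (e i) (fun l => ?_) hw
  induction l with
  | nil => simp [hv.e_eq i hi]
  | cons j l ih =>
    rw [lower_cons, h.e_f i hi j _ _ (h.k_lower hv.k_eq l)]
    exact add_mem (Submodule.smul_mem _ _ (map_mem_lowerSpan f v j ih))
      (Submodule.smul_mem _ _ (lower_mem_lowerSpan f l v))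

theorem lowerSpan_eq_top (h : IsTriangular Θ s ε c k e f) (hirr : IsIrred Θ k e f) {v : W}
    (hv : IsHighest Θ k e χ v) (h0 : v ≠ 0) : lowerSpan f v = ⊤ := by
  refine (hirr (lowerSpan f v) (fun b w => h.k_mem_lowerSpan hv.k_eq b)
    (fun i hi w => h.e_mem_lowerSpan hv hi) (fun i _ w => map_mem_lowerSpan f v i)).resolve_left ?_
  intro hbot
  exact h0 ((Submodule.eq_bot_iff _).1 hbot v (mem_lowerSpan_self f v))

/-- If no non-empty product of lowering operators has trivial weight, a vector of weight `χ` in the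
span lowered from `v`, itself of weight `χ`, is a multiple of `v`. -/
theorem mem_span_of_mem_lowerSpan (h : IsTriangular Θ s ε c k e f)
    (hs : ∀ l : List J, (∀ b, (l.map (s b)).prod = 1) → l = []) (hχ : ∀ b, χ b ≠ 0) {v : W}
    (hv : ∀ b, k b v = χ b • v) {y : W} (hy : ∀ b, k b y = χ b • y)
    (hmem : y ∈ lowerSpan f v) : ∃ a : ℂ, y = a • v := by
  have hle : lowerSpan f v ≤ (ℂ ∙ v) ⊔
      Submodule.span ℂ (Set.range fun l : {l : List J // l ≠ []} => lower f l.1 v) := by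
    refine Submodule.span_le.2 ?_
    rintro _ ⟨l, rfl⟩
    by_cases hl : l = []
    · subst hl
      simpa using Submodule.mem_sup_left (Submodule.mem_span_singleton_self v)
    · exact Submodule.mem_sup_right (Submodule.subset_span ⟨⟨l, hl⟩, rfl⟩)
  obtain ⟨x, hx, z, hz, rfl⟩ := Submodule.mem_sup.1 (hle hmem)
  obtain ⟨a, rfl⟩ := Submodule.mem_span_singleton.1 hx
  refine ⟨a, ?_⟩
  by_cases hz0 : z = 0
  · simp [hz0]
  have hkz : ∀ b, k b z = χ b • z := by
    intro b
    have := hy b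
    rw [map_add, map_smul, hv, smul_comm, smul_add] at this
    exact add_left_cancel this
  obtain ⟨⟨l, hl⟩, hlχ⟩ := exists_eigenvalues_eq_of_mem_span h.comm _ _
    (fun (l : {l : List J // l ≠ []}) b => h.k_lower hv l.1 b) hkz hz hz0
  refine absurd (hs l fun b => ?_) hl
  have := congrFun hlχ b
  exact mul_left_cancel₀ (hχ b) (by simpa using this)

/-- Uniqueness of the highest weight vector of an irreducible module. -/
theorem highest_unique (h : IsTriangular Θ s ε c k e f) (hirr : IsIrred Θ k e f)
    (hs : ∀ l : List J, (∀ b, (l.map (s b)).prod = 1) → l = []) (hχ : ∀ b, χ b ≠ 0) {v u : W}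
    (hv : IsHighest Θ k e χ v) (hv0 : v ≠ 0) (hu : IsHighest Θ k e ψ u) (hu0 : u ≠ 0) :
    ψ = χ ∧ ∃ a : ℂ, u = a • v := by
  have hvt := h.lowerSpan_eq_top hirr hv hv0
  have hut := h.lowerSpan_eq_top hirr hu hu0
  obtain ⟨l, hl⟩ := exists_eigenvalues_eq_of_mem_span h.comm _ _ (h.k_lower hv.k_eq) hu.k_eq
    (by change u ∈ lowerSpan f v; simp [hvt]) hu0
  obtain ⟨l', hl'⟩ := exists_eigenvalues_eq_of_mem_span h.comm _ _ (h.k_lower hu.k_eq) hv.k_eq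
    (by change v ∈ lowerSpan f u; simp [hut]) hv0
  have hnil : l ++ l' = [] := hs _ fun b => by
    have h1 := congrFun hl b
    have h2 := congrFun hl' b
    rw [← h1, mul_assoc] at h2
    rw [List.map_append, List.prod_append]
    exact mul_left_cancel₀ (hχ b) (by simpa using h2)
  have hψ : ψ = χ := by
    rw [(List.append_eq_nil_iff.1 hnil).1] at hl
    rw [← hl]
    funext b
    simp
  subst hψ
  exact ⟨rfl, h.mem_span_of_mem_lowerSpan hs hχ hv.k_eq hu.k_eq (by simp [hvt])⟩

theorem prod (h : IsTriangular Θ s ε c k e f) (h' : IsTriangular Θ s ε c k' e' f') :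
    IsTriangular Θ s ε c (fun b => (k b).prodMap (k' b)) (fun i => (e i).prodMap (e' i))
      (fun i => (f i).prodMap (f' i)) where
  comm a b := by
    refine LinearMap.ext fun w => ?_
    simpa using ⟨congrArg (fun T => T w.1) (h.comm a b), congrArg (fun T => T w.2) (h'.comm a b)⟩
  k_f b j w := by simp [h.k_f, h'.k_f]
  e_f i hi j χ w hw := by
    have hw' : ∀ b, k b w.1 = χ b • w.1 ∧ k' b w.2 = χ b • w.2 := fun b => by
      simpa [Prod.ext_iff] using hw b
    ext
    · simp [h.e_f i hi j χ w.1 fun b => (hw' b).1]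
    · simp [h'.e_f i hi j χ w.2 fun b => (hw' b).2]

theorem lower_prod (l : List J) (w : W × V) :
    lower (fun i => (f i).prodMap (f' i)) l w = (lower f l w.1, lower f' l w.2) := by
  induction l with
  | nil => simp
  | cons j l ih => simp [ih]

/-- Let `v` generate `W` under the lowering operators and let `u` be a highest weight vector of the
same weight in `V`, where `V` is irreducible over the operators of `Θ` and the other lowering
operators act on it by zero. Then there is an intertwiner `W → V` sending `v` to `u`.

Its graph is the subspace generated by `(v, u)`. The vectors `y` with `(0, y)` in this subspace form
a submodule of `V`, and `u` is not among them since the weight space of `(v, u)` in the subspace is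
a line; hence the submodule is zero. -/
theorem exists_intertwiner (h : IsTriangular Θ s ε c k e f)
    (h' : IsTriangular Θ s ε c k' e' f') (hirr : IsIrred Θ k' e' f')
    (hs : ∀ l : List J, (∀ b, (l.map (s b)).prod = 1) → l = []) (hχ : ∀ b, χ b ≠ 0) {v : W}
    (hv : IsHighest Θ k e χ v) (hv0 : v ≠ 0) (hvt : lowerSpan f v = ⊤) {u : V}
    (hu : IsHighest Θ k' e' χ u) (hu0 : u ≠ 0) :
    ∃ φ : W →ₗ[ℂ] V, φ v = u ∧ (∀ b w, φ (k b w) = k' b (φ w)) ∧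
      (∀ i ∈ Θ, ∀ w, φ (e i w) = e' i (φ w)) ∧ ∀ i w, φ (f i w) = f' i (φ w) := by
  have hp := h.prod h'
  set F := fun i => (f i).prodMap (f' i) with hF
  set G : Submodule ℂ (W × V) := lowerSpan F (v, u) with hG
  have hvu : IsHighest Θ (fun b => (k b).prodMap (k' b)) (fun i => (e i).prodMap (e' i)) χ (v, u) :=
    ⟨fun b => by simp [hv.k_eq, hu.k_eq], fun i hi => by simp [hv.e_eq i hi, hu.e_eq i hi]⟩
  have hkG : ∀ b x, x ∈ G → (k b x.1, k' b x.2) ∈ G := fun b x hx =>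
    hp.k_mem_lowerSpan hvu.k_eq b hx
  have heG : ∀ i ∈ Θ, ∀ x, x ∈ G → (e i x.1, e' i x.2) ∈ G := fun i hi x hx =>
    hp.e_mem_lowerSpan hvu hi hx
  have hfG : ∀ i x, x ∈ G → (f i x.1, f' i x.2) ∈ G := fun i x hx =>
    map_mem_lowerSpan F (v, u) i hx
  have hN : G.comap (LinearMap.inr ℂ W V) = ⊥ := by
    refine (hirr _ (fun b w hw => ?_) (fun i hi w hw => ?_) (fun i hi w hw => ?_)).resolve_right ?_
    · simpa using hkG b _ hw
    · simpa using heG i hi _ hw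
    · simpa using hfG i _ hw
    · intro htop
      have hmem : ((0 : W), u) ∈ G := by
        have : u ∈ G.comap (LinearMap.inr ℂ W V) := by simp [htop]
        simpa using this
      obtain ⟨a, ha⟩ := hp.mem_span_of_mem_lowerSpan hs hχ hvu.k_eq
        (fun b => by simp [hu.k_eq]) hmem
      simp only [Prod.smul_mk, Prod.mk.injEq] at ha
      have ha0 : a = 0 := (smul_eq_zero.1 ha.1.symm).resolve_right hv0
      exact hu0 (by rw [ha.2, ha0, zero_smul])
  have huniq : ∀ x ∈ G, x.1 = 0 → x = 0 := by
    rintro ⟨x, y⟩ hx rfl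
    have : y ∈ G.comap (LinearMap.inr ℂ W V) := by simpa using hx
    rw [hN, Submodule.mem_bot] at this
    simp [this]
  have hbij : Function.Bijective ((LinearMap.fst ℂ W V).comp G.subtype) := by
    constructor
    · rw [injective_iff_map_eq_zero]
      intro x hx
      exact Subtype.ext (huniq x.1 x.2 hx)
    · intro w
      have : (⊤ : Submodule ℂ W) ≤ LinearMap.range ((LinearMap.fst ℂ W V).comp G.subtype) := by
        rw [← hvt]
        refine Submodule.span_le.2 ?_
        rintro _ ⟨l, rfl⟩
        exact ⟨⟨_, lower_mem_lowerSpan F l (v, u)⟩, by simp [hF, lower_prod]⟩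
      exact this trivial
  let E := LinearEquiv.ofBijective _ hbij
  let φ : W →ₗ[ℂ] V := (LinearMap.snd ℂ W V).comp (G.subtype.comp E.symm.toLinearMap)
  have hφ : ∀ w, (w, φ w) ∈ G := by
    intro w
    have h1 : (E.symm w : W × V).1 = w := E.apply_symm_apply w
    have h2 : (w, φ w) = (E.symm w : W × V) := Prod.ext h1.symm rfl
    rw [h2]
    exact (E.symm w).2
  have hval : ∀ w y, (w, y) ∈ G → φ w = y := by
    intro w y hy
    have := huniq _ (G.sub_mem (hφ w) hy) (by simp)
    simpa [sub_eq_zero] using this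
  exact ⟨φ, hval _ _ (mem_lowerSpan_self F _), fun b w => hval _ _ (hkG b _ (hφ w)),
    fun i hi w => hval _ _ (heG i hi _ (hφ w)), fun i w => hval _ _ (hfG i _ (hφ w))⟩

end IsTriangular

end Triangular

/-! ### Parity -/

section Parity

theorem zmod_two_cases (x : ZMod 2) : x = 0 ∨ x = 1 := by
  revert x; decide

@[simp] theorem sgn_zero : sgn 0 = 1 := by simp [sgn]

@[simp] theorem sgn_one : sgn 1 = -1 := by
  have : (1 : ZMod 2).val = 1 := rfl
  simp [sgn, this]

theorem sgn_add (x y : ZMod 2) : sgn (x + y) = sgn x * sgn y := by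
  have h : (1 + 1 : ZMod 2) = 0 := rfl
  rcases zmod_two_cases x with rfl | rfl <;> rcases zmod_two_cases y with rfl | rfl <;> simp [h]

theorem sgn_mul_self (x : ZMod 2) : sgn x * sgn x = 1 := by
  rcases zmod_two_cases x with rfl | rfl <;> simp

theorem sgn_ne_zero (x : ZMod 2) : sgn x ≠ 0 := by
  rcases zmod_two_cases x with rfl | rfl <;> simp

variable {W : Type*} [AddCommGroup W] [Module ℂ W] {𝒲 : ZMod 2 → Submodule ℂ W}

/-- A `ℤ/2`-grading is the eigenspace decomposition of an involution. -/
theorem exists_parityOp (h : DirectSum.IsInternal 𝒲) :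
    ∃ P : Module.End ℂ W, (∀ j w, w ∈ 𝒲 j ↔ P w = sgn j • w) ∧ ∀ w, P (P w) = w := by
  have hc : IsCompl (𝒲 0) (𝒲 1) := h.isCompl (by decide)
    (Set.ext fun x => by simpa using zmod_two_cases x)
  set p := (𝒲 0).projection (𝒲 1) hc with hp
  have hpp : ∀ w, p (p w) = p w := fun w =>
    Submodule.projection_apply_of_mem_left hc (Submodule.projection_apply_mem hc w)
  refine ⟨(2 : ℂ) • p - 1, fun j w => ?_, fun w => ?_⟩
  · rcases zmod_two_cases j with rfl | rfl
    · rw [← Submodule.projection_eq_self_iff hc]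
      simp only [LinearMap.sub_apply, LinearMap.smul_apply, Module.End.one_apply, sgn_zero,
        one_smul, sub_eq_iff_eq_add, ← two_smul ℂ w]
      exact (smul_right_injective W (two_ne_zero (α := ℂ))).eq_iff.symm
    · rw [← Submodule.projection_apply_eq_zero_iff hc]
      simp [← hp]
  · simp only [LinearMap.sub_apply, LinearMap.smul_apply, Module.End.one_apply, map_sub, map_smul,
      hpp]
    module

/-- The decomposition of a vector into its homogeneous parts `(w ± P w) / 2`. -/
theorem eq_half_add_half (P : Module.End ℂ W) (w : W) :
    w = (1 / 2 : ℂ) • (w + P w) + (1 / 2 : ℂ) • (w - P w) := by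
  module

theorem add_smul_parityOp_mem {P : Module.End ℂ W} (hP : ∀ j w, w ∈ 𝒲 j ↔ P w = sgn j • w)
    (hPP : ∀ w, P (P w) = w) (j : ZMod 2) (w : W) : w + sgn j • P w ∈ 𝒲 j := by
  rw [hP, map_add, map_smul, hPP, smul_add, smul_smul, sgn_mul_self, one_smul, add_comm]

theorem ext_homogeneous {V : Type*} [AddCommGroup V] [Module ℂ V] (h : DirectSum.IsInternal 𝒲)
    {φ ψ : W →ₗ[ℂ] V} (hφ : ∀ j, ∀ w ∈ 𝒲 j, φ w = ψ w) : φ = ψ := by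
  obtain ⟨P, hP, hPP⟩ := exists_parityOp h
  ext w
  have h0 := hφ 0 _ (add_smul_parityOp_mem hP hPP 0 w)
  have h1 := hφ 1 _ (add_smul_parityOp_mem hP hPP 1 w)
  simp only [sgn_zero, one_smul, sgn_one, neg_smul, ← sub_eq_add_neg] at h0 h1
  rw [eq_half_add_half P w, map_add, map_add, map_smul, map_smul, h0, h1, map_smul, map_smul]

/-- Parity operators commute with operators of degree `p` up to the sign of `p`. -/
theorem parityOp_comm (h : DirectSum.IsInternal 𝒲) {P : Module.End ℂ W}
    (hP : ∀ j w, w ∈ 𝒲 j ↔ P w = sgn j • w) {T : Module.End ℂ W} {p : ZMod 2}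
    (hT : ∀ j, ∀ w ∈ 𝒲 j, T w ∈ 𝒲 (p + j)) (w : W) : P (T w) = sgn p • T (P w) := by
  have : P ∘ₗ T = sgn p • (T ∘ₗ P) := ext_homogeneous h fun j w hw => by
    have h1 := (hP _ _).1 (hT j w hw)
    have h2 := (hP _ _).1 hw
    simp [h1, h2, sgn_add, smul_smul]
  exact congrArg (fun S => S w) this

theorem exists_twistOp (h : DirectSum.IsInternal 𝒲) (θ : ZMod 2) :
    ∃ T : Module.End ℂ W, ∀ j, ∀ w ∈ 𝒲 j, T w = sgn (j * θ) • w := by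
  obtain ⟨P, hP, -⟩ := exists_parityOp h
  rcases zmod_two_cases θ with rfl | rfl
  · exact ⟨1, by simp⟩
  · exact ⟨P, fun j w hw => by simpa using (hP j w).1 hw⟩

end Parity

/-! ### Graded operators of triangular type -/

section SuperTriangular

variable {I J : Type*} {W V : Type*} [AddCommGroup W] [Module ℂ W] [AddCommGroup V] [Module ℂ V]

/-- Operators of triangular type on a `ℤ/2`-graded space: the `k b` are even, `e i` and `f i` have
degree `p i`. -/
structure IsSuperTriangular (𝒲 : ZMod 2 → Submodule ℂ W) (p : J → ZMod 2) (Θ : Set J)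
    (s : I → J → ℂ) (ε : J → J → ℂ) (c : J → J → (I → ℂ) → ℂ)
    (k : I → Module.End ℂ W) (e f : J → Module.End ℂ W) : Prop
    extends IsTriangular Θ s ε c k e f where
  isInternal : DirectSum.IsInternal 𝒲
  k_mem : ∀ b j, ∀ w ∈ 𝒲 j, k b w ∈ 𝒲 j
  e_mem : ∀ i ∈ Θ, ∀ j, ∀ w ∈ 𝒲 j, e i w ∈ 𝒲 (p i + j)
  f_mem : ∀ i j, ∀ w ∈ 𝒲 j, f i w ∈ 𝒲 (p i + j)

/-- There is no proper non-zero graded subspace stable under all `k b` and under `e i`, `f i` for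
`i ∈ Θ`. -/
def IsSuperIrred (𝒲 : ZMod 2 → Submodule ℂ W) (Θ : Set J) (k : I → Module.End ℂ W)
    (e f : J → Module.End ℂ W) : Prop :=
  ∀ N : Submodule ℂ W, N = (N ⊓ 𝒲 0) ⊔ (N ⊓ 𝒲 1) → (∀ b, ∀ w ∈ N, k b w ∈ N) →
    (∀ i ∈ Θ, ∀ w ∈ N, e i w ∈ N) → (∀ i ∈ Θ, ∀ w ∈ N, f i w ∈ N) → N = ⊥ ∨ N = ⊤

namespace IsSuperTriangular

variable {𝒲 : ZMod 2 → Submodule ℂ W} {𝒱 : ZMod 2 → Submodule ℂ V} {p : J → ZMod 2}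
  {Θ : Set J} {s : I → J → ℂ} {ε : J → J → ℂ} {c : J → J → (I → ℂ) → ℂ}
  {k : I → Module.End ℂ W} {e f : J → Module.End ℂ W}
  {k' : I → Module.End ℂ V} {e' f' : J → Module.End ℂ V} {χ ψ : I → ℂ}

/-- The device that reduces graded statements to ungraded ones: a multiple of the parity operator is
adjoined to the operators `k` as one more commuting operator, indexed by `none`. -/
theorem adjoin_parityOp (h : IsSuperTriangular 𝒲 p Θ s ε c k e f) {P : Module.End ℂ W}
    (hP : ∀ j w, w ∈ 𝒲 j ↔ P w = sgn j • w) (δ : ℂ) :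
    IsTriangular Θ (fun o : Option I => o.elim (fun j => sgn (p j)) s) ε
      (fun i j χ => c i j fun b => χ (some b)) (fun o => o.elim (δ • P) k) e f := by
  have hPk : ∀ b w, P (k b w) = k b (P w) := fun b w => by
    simpa using parityOp_comm h.isInternal hP (p := 0) (by simpa using h.k_mem b) w
  refine ⟨?_, ?_, fun i hi j χ w hw => h.e_f i hi j _ w fun b => hw (some b)⟩
  · rintro (_ | a) (_ | b)
    · exact Commute.refl _
    · exact LinearMap.ext fun w => by simp [hPk]
    · exact LinearMap.ext fun w => by simp [hPk]
    · exact h.comm a b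
  · rintro (_ | b) j w
    · simp [parityOp_comm h.isInternal hP (h.f_mem j), smul_comm δ]
    · exact h.k_f b j w

theorem isIrred_adjoin_parityOp (hirr : IsSuperIrred 𝒲 Θ k e f) {P : Module.End ℂ W}
    (hP : ∀ j w, w ∈ 𝒲 j ↔ P w = sgn j • w) (hPP : ∀ w, P (P w) = w) {δ : ℂ} (hδ : δ ≠ 0) :
    IsIrred Θ (fun o : Option I => o.elim (δ • P) k) e f := by
  refine fun N hk he hf => hirr N (le_antisymm (fun w hw => ?_) (by simp)) (fun b => hk (some b))
    he hf
  have hPw : P w ∈ N := by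
    have := N.smul_mem δ⁻¹ (hk none w hw)
    simpa [smul_smul, hδ] using this
  have h0 := add_smul_parityOp_mem hP hPP 0 w
  have h1 := add_smul_parityOp_mem hP hPP 1 w
  simp only [sgn_zero, one_smul, sgn_one, neg_smul, ← sub_eq_add_neg] at h0 h1
  rw [eq_half_add_half P w]
  exact add_mem
    (Submodule.mem_sup_left (Submodule.smul_mem _ _ ⟨N.add_mem hw hPw, h0⟩))
    (Submodule.mem_sup_right (Submodule.smul_mem _ _ ⟨N.sub_mem hw hPw, h1⟩))

theorem isHighest_adjoin_parityOp {P : Module.End ℂ W} (hP : ∀ j w, w ∈ 𝒲 j ↔ P w = sgn j • w)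
    {v : W} (hv : IsHighest Θ k e χ v) {j : ZMod 2} (hvj : v ∈ 𝒲 j) (δ : ℂ) :
    IsHighest Θ (fun o : Option I => o.elim (δ • P) k) e
      (fun o => o.elim (δ * sgn j) χ) v := by
  refine ⟨?_, hv.e_eq⟩
  rintro (_ | b)
  · simp [(hP j v).1 hvj, smul_smul]
  · exact hv.k_eq b

/-- The homogeneous parts of a highest weight vector are highest weight vectors. -/
theorem isHighest_add_smul_parityOp (h : IsSuperTriangular 𝒲 p Θ s ε c k e f)
    {P : Module.End ℂ W} (hP : ∀ j w, w ∈ 𝒲 j ↔ P w = sgn j • w) {v : W}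
    (hv : IsHighest Θ k e χ v) (δ : ℂ) : IsHighest Θ k e χ (v + δ • P v) := by
  refine ⟨fun b => ?_, fun i hi => ?_⟩
  · have := parityOp_comm h.isInternal hP (p := 0) (by simpa using h.k_mem b) v
    simp only [sgn_zero, one_smul] at this
    rw [map_add, map_smul, ← this, hv.k_eq, map_smul, smul_add, smul_comm δ]
  · have := parityOp_comm h.isInternal hP (h.e_mem i hi) v
    rw [hv.e_eq i hi, map_zero] at this
    have h0 := (smul_eq_zero.1 this.symm).resolve_left (sgn_ne_zero _)
    simp [hv.e_eq i hi, h0]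

theorem exists_homogeneous_highest (h : IsSuperTriangular 𝒲 p Θ s ε c k e f) {v : W}
    (hv : IsHighest Θ k e χ v) (hv0 : v ≠ 0) :
    ∃ j, ∃ u ∈ 𝒲 j, u ≠ 0 ∧ IsHighest Θ k e χ u := by
  obtain ⟨P, hP, hPP⟩ := exists_parityOp h.isInternal
  by_contra! hcon
  have hzero : ∀ j, v + sgn j • P v = 0 := fun j => by
    by_contra h0
    exact hcon j _ (add_smul_parityOp_mem hP hPP j v) h0 (h.isHighest_add_smul_parityOp hP hv _)
  have h0 := hzero 0
  have h1 := hzero 1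
  simp only [sgn_zero, one_smul, sgn_one, neg_smul, ← sub_eq_add_neg] at h0 h1
  exact hv0 (by rw [eq_half_add_half P v, h0, h1]; simp)

theorem separated_adjoin_parity (hs : ∀ l : List J, (∀ b, (l.map (s b)).prod = 1) → l = [])
    (l : List J) (hl : ∀ o : Option I,
      (l.map ((fun o : Option I => o.elim (fun j => sgn (p j)) s) o)).prod = 1) : l = [] :=
  hs l fun b => hl (some b)

theorem elim_ne_zero (hχ : ∀ b, χ b ≠ 0) {x : ℂ} (hx : x ≠ 0) (o : Option I) :
    o.elim x χ ≠ 0 := by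
  cases o
  · exact hx
  · exact hχ _

theorem lowerSpan_eq_top_of_irred (h : IsSuperTriangular 𝒲 p Θ s ε c k e f)
    (hirr : IsSuperIrred 𝒲 Θ k e f) {v : W} {j : ZMod 2} (hvj : v ∈ 𝒲 j)
    (hv : IsHighest Θ k e χ v) (hv0 : v ≠ 0) : lowerSpan f v = ⊤ := by
  obtain ⟨P, hP, hPP⟩ := exists_parityOp h.isInternal
  exact (h.adjoin_parityOp hP 1).lowerSpan_eq_top (isIrred_adjoin_parityOp hirr hP hPP one_ne_zero)
    (isHighest_adjoin_parityOp hP hv hvj 1) hv0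

theorem super_highest_unique (h : IsSuperTriangular 𝒲 p Θ s ε c k e f)
    (hirr : IsSuperIrred 𝒲 Θ k e f)
    (hs : ∀ l : List J, (∀ b, (l.map (s b)).prod = 1) → l = []) (hχ : ∀ b, χ b ≠ 0) {v u : W}
    {j : ZMod 2} (hvj : v ∈ 𝒲 j) (hv : IsHighest Θ k e χ v) (hv0 : v ≠ 0)
    (hu : IsHighest Θ k e ψ u) (hu0 : u ≠ 0) : ψ = χ ∧ ∃ a : ℂ, u = a • v := by
  obtain ⟨P, hP, hPP⟩ := exists_parityOp h.isInternal
  have hom : ∀ x : W, ∀ i, x ∈ 𝒲 i → IsHighest Θ k e ψ x → x ≠ 0 →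
      ψ = χ ∧ ∃ a : ℂ, x = a • v := by
    intro x i hxi hx hx0
    obtain ⟨h1, h2⟩ := (h.adjoin_parityOp hP 1).highest_unique
      (isIrred_adjoin_parityOp hirr hP hPP one_ne_zero) (separated_adjoin_parity hs)
      (elim_ne_zero hχ (mul_ne_zero one_ne_zero (sgn_ne_zero j)))
      (isHighest_adjoin_parityOp hP hv hvj 1) hv0 (isHighest_adjoin_parityOp hP hx hxi 1) hx0
    exact ⟨funext fun b => congrFun h1 (some b), h2⟩
  have part : ∀ i, ∃ a : ℂ, u + sgn i • P u = a • v := by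
    intro i
    by_cases h0 : u + sgn i • P u = 0
    · exact ⟨0, by simp [h0]⟩
    · exact (hom _ i (add_smul_parityOp_mem hP hPP i u)
        (h.isHighest_add_smul_parityOp hP hu _) h0).2
  constructor
  · obtain ⟨i, x, hxi, hx0, hx⟩ := h.exists_homogeneous_highest hu hu0
    exact (hom x i hxi hx hx0).1
  · obtain ⟨a, ha⟩ := part 0
    obtain ⟨b, hb⟩ := part 1
    simp only [sgn_zero, one_smul, sgn_one, neg_smul, ← sub_eq_add_neg] at ha hb
    refine ⟨(1 / 2 : ℂ) * a + (1 / 2 : ℂ) * b, ?_⟩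
    rw [eq_half_add_half P u, ha, hb, smul_smul, smul_smul, ← add_smul]

/-- The intertwiner between highest weight vectors of degrees `i` and `j` can be chosen of degree
`i + j`, and still commuting with all operators without signs: the parity operator of `V` is
rescaled by the sign of `i + j` so that both vectors have the same eigenvalue. -/
theorem exists_homogeneous_intertwiner (h : IsSuperTriangular 𝒲 p Θ s ε c k e f)
    (h' : IsSuperTriangular 𝒱 p Θ s ε c k' e' f') (hirr : IsSuperIrred 𝒱 Θ k' e' f')
    (hs : ∀ l : List J, (∀ b, (l.map (s b)).prod = 1) → l = []) (hχ : ∀ b, χ b ≠ 0)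
    {i j : ZMod 2} {v : W} (hvi : v ∈ 𝒲 i) (hv : IsHighest Θ k e χ v) (hv0 : v ≠ 0)
    (hvt : lowerSpan f v = ⊤) {u : V} (huj : u ∈ 𝒱 j) (hu : IsHighest Θ k' e' χ u)
    (hu0 : u ≠ 0) :
    ∃ φ : W →ₗ[ℂ] V, φ v = u ∧ (∀ x, ∀ w ∈ 𝒲 x, φ w ∈ 𝒱 (x + (i + j))) ∧
      (∀ b w, φ (k b w) = k' b (φ w)) ∧
      (∀ a ∈ Θ, ∀ w, φ (e a w) = e' a (φ w)) ∧ ∀ a w, φ (f a w) = f' a (φ w) := by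
  obtain ⟨P, hP, hPP⟩ := exists_parityOp h.isInternal
  obtain ⟨P', hP', hPP'⟩ := exists_parityOp h'.isInternal
  have hsgn : sgn (i + j) * sgn j = 1 * sgn i := by
    rw [sgn_add, mul_assoc, sgn_mul_self, mul_one, one_mul]
  have huχ := isHighest_adjoin_parityOp hP' hu huj (sgn (i + j))
  rw [hsgn] at huχ
  obtain ⟨φ, hφv, hφk, hφe, hφf⟩ :=
    (h.adjoin_parityOp hP 1).exists_intertwiner (h'.adjoin_parityOp hP' (sgn (i + j)))
      (isIrred_adjoin_parityOp hirr hP' hPP' (sgn_ne_zero _)) (separated_adjoin_parity hs)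
      (elim_ne_zero hχ (mul_ne_zero one_ne_zero (sgn_ne_zero i)))
      (isHighest_adjoin_parityOp hP hv hvi 1) hv0 hvt huχ hu0
  refine ⟨φ, hφv, fun x w hw => ?_, fun b w => hφk (some b) w, hφe, hφf⟩
  have h1 := hφk none w
  simp only [Option.elim_none, one_smul, (hP x w).1 hw, map_smul, LinearMap.smul_apply] at h1
  rw [hP', add_comm x, sgn_add, mul_smul, h1, smul_smul, sgn_mul_self, one_smul]

end IsSuperTriangular

end SuperTriangular

/-! ### The dimension of the space of homomorphisms -/

section SuperHom

variable {A : Type*} [Semiring A] [Algebra ℂ A] {𝒜 : ZMod 2 → Submodule ℂ A}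
variable {I J : Type*} {W V : Type*} [AddCommGroup W] [Module ℂ W] [AddCommGroup V] [Module ℂ V]
  {𝒲 : ZMod 2 → Submodule ℂ W} {𝒱 : ZMod 2 → Submodule ℂ V}
  {ρ : A →ₐ[ℂ] Module.End ℂ W} {τ : A →ₐ[ℂ] Module.End ℂ V}
  {Θ : Set J} {K Ki : I → A} {E F : J → A} {p : J → ZMod 2}

theorem intertwines_of_generators (hKKi : ∀ b, K b * Ki b = 1) (hKiK : ∀ b, Ki b * K b = 1)
    (hgen : Algebra.adjoin ℂ (Set.range K ∪ Set.range Ki ∪ E '' Θ ∪ Set.range F) = ⊤)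
    {φ : W →ₗ[ℂ] V} (hK : ∀ b w, φ (ρ (K b) w) = τ (K b) (φ w))
    (hE : ∀ i ∈ Θ, ∀ w, φ (ρ (E i) w) = τ (E i) (φ w))
    (hF : ∀ i w, φ (ρ (F i) w) = τ (F i) (φ w)) (a : A) (w : W) :
    φ (ρ a w) = τ a (φ w) := by
  have ha : a ∈ Algebra.adjoin ℂ (Set.range K ∪ Set.range Ki ∪ E '' Θ ∪ Set.range F) := by
    rw [hgen]; trivial
  induction ha using Algebra.adjoin_induction generalizing w with
  | mem x hx =>
    rcases hx with ((⟨b, rfl⟩ | ⟨b, rfl⟩) | ⟨i, hi, rfl⟩) | ⟨i, rfl⟩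
    · exact hK b w
    · have h1 := hK b (ρ (Ki b) w)
      rw [← Module.End.mul_apply, ← map_mul, hKKi, map_one, Module.End.one_apply] at h1
      rw [h1, ← Module.End.mul_apply, ← map_mul, hKiK, map_one, Module.End.one_apply]
    · exact hE i hi w
    · exact hF i w
  | algebraMap r => simp [Module.algebraMap_end_apply]
  | add x y _ _ hx hy => simp [hx, hy]
  | mul x y _ _ hx hy => simp [hx, hy]

/-- A homomorphism killing a vector that generates `W` under lowering operators is zero. -/
theorem homDeg_eq_zero (hF : ∀ i, F i ∈ 𝒜 (p i)) {v : W}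
    (hvt : lowerSpan (fun i => ρ (F i)) v = ⊤) {θ : ZMod 2} {φ : W →ₗ[ℂ] V}
    (hφ : φ ∈ homDeg 𝒜 𝒲 𝒱 ρ τ θ) (h0 : φ v = 0) : φ = 0 := by
  have key : ∀ l, φ (lower (fun i => ρ (F i)) l v) ∈ (⊥ : Submodule ℂ V) := by
    intro l
    induction l with
    | nil => simp [h0]
    | cons j l ih =>
      have h1 := hφ.2 (p j) (F j) (hF j) (lower (fun i => ρ (F i)) l v)
      rw [(Submodule.mem_bot ℂ).1 ih, map_zero] at h1
      simpa using (smul_eq_zero.1 h1.symm).resolve_left (sgn_ne_zero _)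
  ext w
  have := map_mem_of_mem_lowerSpan φ key (w := w) (by rw [hvt]; trivial)
  simpa using this

/-- Homogeneous homomorphisms preserve highest weight vectors. -/
theorem isHighest_homDeg (hK : ∀ b, K b ∈ 𝒜 0) (hE : ∀ i ∈ Θ, E i ∈ 𝒜 (p i)) {χ : I → ℂ} {v : W}
    (hv : IsHighest Θ (fun b => ρ (K b)) (fun i => ρ (E i)) χ v) {θ : ZMod 2} {φ : W →ₗ[ℂ] V}
    (hφ : φ ∈ homDeg 𝒜 𝒲 𝒱 ρ τ θ) :
    IsHighest Θ (fun b => τ (K b)) (fun i => τ (E i)) χ (φ v) := by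
  refine ⟨fun b => ?_, fun i hi => ?_⟩
  · rw [hφ.2 0 _ (hK b), hv.k_eq]
    simp
  · rw [hφ.2 _ _ (hE i hi), hv.e_eq i hi, map_zero, smul_zero]

/-- The dimension of the space of homomorphisms from `W`, generated by a highest weight vector `v`
under lowering operators, to `V`, on which the lowering operators outside `Θ` vanish and which is
irreducible over the operators of `Θ`. A homomorphism is determined by the image of `v`, which lies
on the line of highest weight vectors of `V`. -/
theorem finrank_superHom (hKKi : ∀ b, K b * Ki b = 1) (hKiK : ∀ b, Ki b * K b = 1)
    (hgen : Algebra.adjoin ℂ (Set.range K ∪ Set.range Ki ∪ E '' Θ ∪ Set.range F) = ⊤)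
    (hK : ∀ b, K b ∈ 𝒜 0) (hE : ∀ i ∈ Θ, E i ∈ 𝒜 (p i)) (hF : ∀ i, F i ∈ 𝒜 (p i))
    {s : I → J → ℂ} {ε : J → J → ℂ} {c : J → J → (I → ℂ) → ℂ}
    (hs : ∀ l : List J, (∀ b, (l.map (s b)).prod = 1) → l = [])
    (hρ : IsSuperModule 𝒜 𝒲 ρ)
    (hW : IsTriangular Θ s ε c (fun b => ρ (K b)) (fun i => ρ (E i)) (fun i => ρ (F i)))
    (hV : IsSuperTriangular 𝒱 p Θ s ε c (fun b => τ (K b)) (fun i => τ (E i)) (fun i => τ (F i)))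
    (hirr : IsSuperIrred 𝒱 Θ (fun b => τ (K b)) (fun i => τ (E i)) (fun i => τ (F i)))
    {χ ψ : I → ℂ} (hχ : ∀ b, χ b ≠ 0) (hψ : ∀ b, ψ b ≠ 0) {i : ZMod 2} {v : W} (hvi : v ∈ 𝒲 i)
    (hv0 : v ≠ 0) (hv : IsHighest Θ (fun b => ρ (K b)) (fun i => ρ (E i)) χ v)
    (hvt : lowerSpan (fun i => ρ (F i)) v = ⊤)
    {u : V} (hu0 : u ≠ 0) (hu : IsHighest Θ (fun b => τ (K b)) (fun i => τ (E i)) ψ u) :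
    (χ = ψ → Module.finrank ℂ (superHom 𝒜 𝒲 𝒱 ρ τ) = 1) ∧
      (χ ≠ ψ → Module.finrank ℂ (superHom 𝒜 𝒲 𝒱 ρ τ) = 0) := by
  obtain ⟨j, u', huj, hu0', hu'⟩ := hV.exists_homogeneous_highest hu hu0
  have himage : ∀ θ, ∀ φ ∈ homDeg 𝒜 𝒲 𝒱 ρ τ θ, φ v ≠ 0 → χ = ψ ∧ ∃ a : ℂ, φ v = a • u' :=
    fun θ φ hφ h0 => hV.super_highest_unique hirr hs hψ huj hu' hu0' (isHighest_homDeg hK hE hv hφ)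
      h0
  constructor
  · rintro rfl
    have hWs : IsSuperTriangular 𝒲 p Θ s ε c (fun b => ρ (K b)) (fun i => ρ (E i))
        (fun i => ρ (F i)) :=
      { hW with
        isInternal := hρ.isInternal
        k_mem := fun b x w hw => by simpa using hρ.map_mem 0 x _ w (hK b) hw
        e_mem := fun a ha x w hw => hρ.map_mem _ x _ w (hE a ha) hw
        f_mem := fun a x w hw => hρ.map_mem _ x _ w (hF a) hw }
    obtain ⟨φ₀, hφv, hφdeg, hφk, hφe, hφf⟩ :=
      hWs.exists_homogeneous_intertwiner hV hirr hs hχ hvi hv hv0 hvt huj hu' hu0'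
    have hφ₀ := intertwines_of_generators hKKi hKiK hgen hφk hφe hφf
    -- The sign rule for odd homomorphisms is obtained by composing with the parity operator.
    obtain ⟨T, hT⟩ := exists_twistOp hρ.isInternal (i + j)
    have hTdeg : ∀ x, ∀ w ∈ 𝒲 x, T w ∈ 𝒲 x := fun x w hw => by
      rw [hT x w hw]; exact Submodule.smul_mem _ _ hw
    have hφ : φ₀ ∘ₗ T ∈ homDeg 𝒜 𝒲 𝒱 ρ τ (i + j) := by
      refine ⟨fun x w hw => hφdeg x _ (hTdeg x w hw), fun x a ha w => ?_⟩
      have hcomm : T ∘ₗ ρ a = sgn (x * (i + j)) • (ρ a ∘ₗ T) :=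
        ext_homogeneous hρ.isInternal fun y w hw => by
          simp [hT y w hw, hT _ _ (hρ.map_mem x y a w ha hw), add_mul x y, sgn_add, smul_smul]
      have hTa : T (ρ a w) = sgn (x * (i + j)) • ρ a (T w) := congrArg (fun S => S w) hcomm
      rw [LinearMap.comp_apply, LinearMap.comp_apply, hTa, map_smul, smul_smul, sgn_mul_self,
        one_smul, hφ₀]
    have hφv' : (φ₀ ∘ₗ T) v = sgn (i * (i + j)) • u' := by
      rw [LinearMap.comp_apply, hT i v hvi, map_smul, hφv]
    have hφ0 : φ₀ ∘ₗ T ≠ 0 := by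
      intro h0
      rw [h0, LinearMap.zero_apply] at hφv'
      exact hu0' ((smul_eq_zero.1 hφv'.symm).resolve_left (sgn_ne_zero _))
    have hle : ∀ θ, homDeg 𝒜 𝒲 𝒱 ρ τ θ ≤ ℂ ∙ (φ₀ ∘ₗ T) := by
      intro θ ψ hψ
      by_cases h0 : ψ v = 0
      · rw [homDeg_eq_zero hF hvt hψ h0]
        exact zero_mem _
      obtain ⟨-, a, ha⟩ := himage θ ψ hψ h0
      by_cases hθ : θ = i + j
      · subst hθ
        refine Submodule.mem_span_singleton.2 ⟨a * sgn (i * (i + j)), ?_⟩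
        refine (sub_eq_zero.1 (homDeg_eq_zero hF hvt
          (sub_mem hψ (Submodule.smul_mem _ (a * sgn (i * (i + j))) hφ)) ?_)).symm
        rw [LinearMap.sub_apply, LinearMap.smul_apply, hφv', ha, smul_smul, mul_assoc,
          sgn_mul_self, mul_one, sub_self]
      · refine absurd ?_ h0
        obtain ⟨P, hP, -⟩ := exists_parityOp hV.isInternal
        have hji : j ≠ i + θ := by
          rintro rfl
          apply hθ
          rw [← add_assoc, CharTwo.add_self_eq_zero, zero_add]
        have h1 := (hP _ _).1 (hψ.1 i v hvi)
        have h2 := (hP j _).1 (by rw [ha]; exact Submodule.smul_mem _ a huj : ψ v ∈ 𝒱 j)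
        rw [h1] at h2
        generalize i + θ = y at h2 hji
        rw [← sub_eq_zero, ← sub_smul] at h2
        refine (smul_eq_zero.1 h2).resolve_left ?_
        rcases zmod_two_cases y with rfl | rfl <;> rcases zmod_two_cases j with rfl | rfl <;>
          first
          | exact absurd rfl hji
          | norm_num
    have hspan : superHom 𝒜 𝒲 𝒱 ρ τ = ℂ ∙ (φ₀ ∘ₗ T) := by
      refine le_antisymm (sup_le (hle 0) (hle 1)) ?_
      rw [Submodule.span_singleton_le_iff_mem]
      rcases zmod_two_cases (i + j) with h | h <;> rw [h] at hφ
      · exact Submodule.mem_sup_left hφ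
      · exact Submodule.mem_sup_right hφ
    rw [hspan]
    exact finrank_span_singleton hφ0
  · intro hne
    have hbot : ∀ θ, homDeg 𝒜 𝒲 𝒱 ρ τ θ = ⊥ := fun θ => by
      refine (Submodule.eq_bot_iff _).2 fun φ hφ => homDeg_eq_zero hF hvt hφ ?_
      by_contra h0
      exact hne (himage θ φ hφ h0).1
    rw [superHom, hbot, hbot, sup_bot_eq, finrank_bot]

end SuperHom

/-! ### Generators and relations -/

section Abstract

variable {A : Type*} [Semiring A] [Algebra ℂ A] {I J : Type*}
  {W : Type*} [AddCommGroup W] [Module ℂ W]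
  {Θ : Set J} {K Ki : I → A} {E F : J → A}

theorem inv_eigenvalue (hKiK : ∀ b, Ki b * K b = 1) (ρ : A →ₐ[ℂ] Module.End ℂ W) {b : I} {w : W}
    {x : ℂ} (hw : ρ (K b) w = x • w) : ρ (Ki b) w = x⁻¹ • w := by
  have h1 : ρ (Ki b) (ρ (K b) w) = w := by
    rw [← Module.End.mul_apply, ← map_mul, hKiK, map_one, Module.End.one_apply]
  rw [hw, map_smul] at h1
  by_cases hx : x = 0
  · rw [hx, zero_smul] at h1
    simp [← h1]
  · rw [eq_inv_smul_iff₀ hx, h1]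

/-- The commutation rules of the generators in the algebra make every representation a system of
operators of triangular type. -/
theorem isTriangular_of_relations {A : Type*} [Ring A] [Algebra ℂ A] {K Ki : I → A} {E F : J → A}
    [DecidableEq J] {s : I → J → ℂ} {ε : J → J → ℂ} {γ : J → ℂ}
    {left right : J → I} (hKiK : ∀ b, Ki b * K b = 1) (hKK : ∀ a b, K a * K b = K b * K a)
    (hKF : ∀ b j, K b * F j = s b j • (F j * K b))
    (hEF : ∀ i ∈ Θ, ∀ j, E i * F j = ε i j • (F j * E i) +
      if i = j then γ i • (K (left i) * Ki (right i) - Ki (left i) * K (right i)) else 0)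
    (ρ : A →ₐ[ℂ] Module.End ℂ W) :
    IsTriangular Θ s ε
      (fun i j χ => if i = j then
        γ i * (χ (left i) * (χ (right i))⁻¹ - (χ (left i))⁻¹ * χ (right i)) else 0)
      (fun b => ρ (K b)) (fun i => ρ (E i)) (fun i => ρ (F i)) where
  comm a b := by
    rw [commute_iff_eq, ← map_mul, hKK, map_mul]
  k_f b j w := by
    rw [← Module.End.mul_apply, ← map_mul, hKF, map_smul, map_mul]
    rfl
  e_f i hi j χ w hw := by
    have hw' := fun b => inv_eigenvalue hKiK ρ (hw b)
    rw [← Module.End.mul_apply, ← map_mul, hEF i hi j]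
    split_ifs with hij
    · simp only [map_add, map_smul, map_mul, map_sub, LinearMap.add_apply, LinearMap.smul_apply,
        LinearMap.sub_apply, Module.End.mul_apply, hw, hw', smul_smul, ← sub_smul]
      congr 2
      ring
    · simp

/-- Stability under the inverses `Ki b` need not be assumed: `K b` acts injectively, hence
bijectively, on a stable subspace of finite dimension. -/
theorem mem_of_stable_generators [FiniteDimensional ℂ W] {S T : Set J}
    (hKiK : ∀ b, Ki b * K b = 1)
    (hgen : Algebra.adjoin ℂ (Set.range K ∪ Set.range Ki ∪ E '' S ∪ F '' T) = ⊤)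
    (ρ : A →ₐ[ℂ] Module.End ℂ W) {N : Submodule ℂ W} (hK : ∀ b, ∀ w ∈ N, ρ (K b) w ∈ N)
    (hE : ∀ i ∈ S, ∀ w ∈ N, ρ (E i) w ∈ N) (hF : ∀ i ∈ T, ∀ w ∈ N, ρ (F i) w ∈ N) (a : A) :
    ∀ w ∈ N, ρ a w ∈ N := by
  have ha : a ∈ Algebra.adjoin ℂ (Set.range K ∪ Set.range Ki ∪ E '' S ∪ F '' T) := by
    rw [hgen]; trivial
  induction ha using Algebra.adjoin_induction with
  | mem x hx =>
    rcases hx with ((⟨b, rfl⟩ | ⟨b, rfl⟩) | ⟨i, hi, rfl⟩) | ⟨i, hi, rfl⟩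
    · exact hK b
    · intro w hw
      have hleft : ∀ w, ρ (Ki b) (ρ (K b) w) = w := fun w => by
        rw [← Module.End.mul_apply, ← map_mul, hKiK, map_one, Module.End.one_apply]
      have hinj : Function.Injective ((ρ (K b)).restrict (hK b)) := by
        intro x y hxy
        have h1 : ρ (K b) x = ρ (K b) y := congrArg Subtype.val hxy
        exact Subtype.ext (by rw [← hleft x, h1, hleft])
      obtain ⟨y, hy⟩ := LinearMap.surjective_of_injective hinj ⟨w, hw⟩
      have h2 : ρ (K b) y = w := congrArg Subtype.val hy
      rw [← h2, hleft]
      exact y.2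
    · exact hE i hi
    · exact hF i hi
  | algebraMap r =>
    intro w hw
    simpa [Module.algebraMap_end_apply] using N.smul_mem r hw
  | add x y _ _ hx hy => exact fun w hw => by simpa using add_mem (hx w hw) (hy w hw)
  | mul x y _ _ hx hy => exact fun w hw => by simpa using hx _ (hy w hw)

end Abstract

section Relations

variable {m n : ℕ} {q : ℝ}

/-- The generators `E_{i, i+1}` (for `true`) and `E_{i+1, i}` (for `false`). Treating the two kinds
uniformly lets one argument cover both parabolic subalgebras, with their roles exchanged. -/
def rootGen : Bool → Fin (m + n - 1) → Gen m n
  | true => .E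
  | false => .F

/-- The sign of the weight of `rootGen b i`. -/
def rootSign : Bool → ℤ
  | true => 1
  | false => -1

theorem mkAlgHom_rel {x y : FreeAlgebra ℂ (Gen m n)} (h : Rel m n q x y) :
    RingQuot.mkAlgHom ℂ (Rel m n q) x = RingQuot.mkAlgHom ℂ (Rel m n q) y :=
  RingQuot.mkAlgHom_rel ℂ h

theorem gen_K_mul_Kinv (a : Fin (m + n)) : (gen (.K a) * gen (.Kinv a) : Uq m n q) = 1 := by
  simpa [gen] using mkAlgHom_rel (Rel.K_Kinv (q := q) a)

theorem gen_Kinv_mul_K (a : Fin (m + n)) : (gen (.Kinv a) * gen (.K a) : Uq m n q) = 1 := by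
  simpa [gen] using mkAlgHom_rel (Rel.Kinv_K (q := q) a)

theorem gen_K_mul_K (a b : Fin (m + n)) :
    (gen (.K a) * gen (.K b) : Uq m n q) = gen (.K b) * gen (.K a) := by
  simpa [gen] using mkAlgHom_rel (Rel.K_K (q := q) a b)

theorem gen_K_mul_rootGen (b : Bool) (a : Fin (m + n)) (i : Fin (m + n - 1)) :
    (gen (.K a) * gen (rootGen b i) : Uq m n q) =
      ((qAt m n q a : ℂ) ^ (rootSign b * rootCoeff a i)) • (gen (rootGen b i) * gen (.K a)) := by
  have h : (gen (.K a) * gen (rootGen b i) * gen (.Kinv a) : Uq m n q) =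
      ((qAt m n q a : ℂ) ^ (rootSign b * rootCoeff a i)) • gen (rootGen b i) := by
    cases b
    · simpa [gen, rootGen, rootSign] using mkAlgHom_rel (Rel.K_F (q := q) a i)
    · simpa [gen, rootGen, rootSign] using mkAlgHom_rel (Rel.K_E (q := q) a i)
  rw [← smul_mul_assoc, ← h, mul_assoc, gen_Kinv_mul_K, mul_one]

/-- The coefficient of `K_i K_{i+1}⁻¹ - K_i⁻¹ K_{i+1}` in the super commutator of `rootGen b i` and
`rootGen (!b) i`. -/
noncomputable def commCoeff (m n : ℕ) (q : ℝ) (b : Bool) (i : Fin (m + n - 1)) : ℂ :=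
  (if b then 1 else -sgn (nodeParity i * nodeParity i)) *
    ((qAt m n q (lft i) : ℂ) - (qAt m n q (lft i) : ℂ)⁻¹)⁻¹

theorem gen_rootGen_mul_rootGen (b : Bool) (i j : Fin (m + n - 1)) :
    (gen (rootGen b i) * gen (rootGen (!b) j) : Uq m n q) =
      sgn (nodeParity i * nodeParity j) • (gen (rootGen (!b) j) * gen (rootGen b i)) +
        if i = j then commCoeff m n q b i •
          (gen (.K (lft i)) * gen (.Kinv (rgt i)) - gen (.Kinv (lft i)) * gen (.K (rgt i)))
        else 0 := by
  have main : ∀ i j : Fin (m + n - 1), (gen (.E i) * gen (.F j) : Uq m n q) -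
      sgn (nodeParity i * nodeParity j) • (gen (.F j) * gen (.E i)) =
        if i = j then ((qAt m n q (lft i) : ℂ) - (qAt m n q (lft i) : ℂ)⁻¹)⁻¹ •
          (gen (.K (lft i)) * gen (.Kinv (rgt i)) - gen (.Kinv (lft i)) * gen (.K (rgt i)))
        else 0 := by
    intro i j
    split_ifs with h
    · subst h
      simpa only [gen, map_sub, map_mul, map_smul] using mkAlgHom_rel (Rel.E_F_same (q := q) i)
    · simpa only [gen, map_sub, map_mul, map_smul, map_zero] using
        mkAlgHom_rel (Rel.E_F_ne (q := q) i j h)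
  cases b
  · have h := main j i
    rw [sub_eq_iff_eq_add, mul_comm (nodeParity j)] at h
    change (gen (.F i) * gen (.E j) : Uq m n q) = sgn (nodeParity i * nodeParity j) •
      (gen (.E j) * gen (.F i)) + _
    rw [h, smul_add, smul_smul, sgn_mul_self, one_smul]
    by_cases hij : i = j
    · subst hij
      simp only [commCoeff, if_true, Bool.false_eq_true, if_false, smul_smul]
      module
    · simp [hij, Ne.symm hij]
  · rw [← sub_eq_iff_eq_add']
    simpa [commCoeff, rootGen] using main i j

theorem adjoin_range_gen : Algebra.adjoin ℂ (Set.range (gen : Gen m n → Uq m n q)) = ⊤ := by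
  have h : Set.range (gen : Gen m n → Uq m n q) =
      RingQuot.mkAlgHom ℂ (Rel m n q) '' Set.range (FreeAlgebra.ι ℂ) := by
    rw [← Set.range_comp]
    rfl
  rw [h, ← AlgHom.map_adjoin, FreeAlgebra.adjoin_range_ι, Algebra.map_top,
    AlgHom.range_eq_top]
  exact RingQuot.mkAlgHom_surjective ℂ _

theorem gen_mem_parityPart (g : Gen m n) : (gen g : Uq m n q) ∈ parityPart m n q g.parity :=
  Submodule.subset_span ⟨[g], by simp⟩

theorem parity_rootGen (b : Bool) (i : Fin (m + n - 1)) : (rootGen b i).parity = nodeParity i := by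
  cases b <;> rfl

end Relations

/-! ### Weights -/

section Weights

variable {m n : ℕ} {q : ℝ}

theorem qAt_pos (hq : 0 < q) (a : Fin (m + n)) : 0 < qAt m n q a := by
  unfold qAt
  split_ifs
  · exact hq
  · exact inv_pos.2 hq

theorem qAt_ne_one (hq1 : q ≠ 1) (a : Fin (m + n)) : qAt m n q a ≠ 1 := by
  unfold qAt
  split_ifs
  · exact hq1
  · exact inv_ne_one.2 hq1

theorem list_prod_zpow {x : ℂ} (hx : x ≠ 0) {J : Type*} (g : J → ℤ) (l : List J) :
    (l.map fun j => x ^ g j).prod = x ^ (l.map g).sum := by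
  induction l with
  | nil => simp
  | cons j l ih => simp [ih, zpow_add₀ hx]

/-- A non-empty sum of simple roots is non-zero as a weight: its pairing with the vector
`(0, 1, …, m + n - 1)` is minus the number of summands. -/
theorem eq_nil_of_weight_eq_one (hq : 0 < q) (hq1 : q ≠ 1) (b : Bool) (l : List (Fin (m + n - 1)))
    (hl : ∀ a : Fin (m + n),
      (l.map fun j => (qAt m n q a : ℂ) ^ (rootSign b * rootCoeff a j)).prod = 1) : l = [] := by
  have hb : rootSign b ≠ 0 := by cases b <;> decide
  have hzero : ∀ a : Fin (m + n), (l.map (rootCoeff a)).sum = 0 := by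
    intro a
    have h1 := hl a
    rw [list_prod_zpow (by exact_mod_cast (qAt_pos hq a).ne'), List.sum_map_mul_left] at h1
    have h2 : qAt m n q a ^ (rootSign b * (l.map (rootCoeff a)).sum) = qAt m n q a ^ (0 : ℤ) := by
      rw [zpow_zero]
      exact_mod_cast h1
    have h3 := zpow_right_injective₀ (qAt_pos hq a) (qAt_ne_one hq1 a) h2
    exact (mul_eq_zero.1 h3).resolve_left hb
  have hpair : ∀ l : List (Fin (m + n - 1)),
      ∑ a : Fin (m + n), (a.1 : ℤ) * (l.map (rootCoeff a)).sum = -(l.length : ℤ) := by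
    intro l
    induction l with
    | nil => simp
    | cons j l ih =>
      have hj : ∑ a : Fin (m + n), (a.1 : ℤ) * rootCoeff a j = -1 := by
        simp only [rootCoeff, mul_sub, Finset.sum_sub_distrib, mul_ite, mul_one, mul_zero,
          Finset.sum_ite_eq', Finset.mem_univ, if_true]
        simp [lft, rgt]
      simp only [List.map_cons, List.sum_cons, mul_add, Finset.sum_add_distrib, ih, hj,
        List.length_cons]
      push_cast
      ring
  have := hpair l
  simp only [hzero, mul_zero, Finset.sum_const_zero] at this
  exact List.length_eq_zero_iff.1 (by omega)

theorem log_qAt (a : Fin (m + n)) :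
    Real.log (qAt m n q a) = Real.log q ∨ Real.log (qAt m n q a) = -Real.log q := by
  unfold qAt
  split_ifs
  · exact Or.inl rfl
  · exact Or.inr (Real.log_inv q)

theorem sameWeight_iff (hq : 0 < q) (hq1 : q ≠ 1) (lam mu : Fin (m + n) → ℂ) :
    SameWeight q lam mu ↔
      (fun b => (qAt m n q b : ℂ) ^ lam b) = fun b => (qAt m n q b : ℂ) ^ mu b := by
  have hlog : (Real.log q : ℂ) ≠ 0 := by
    exact_mod_cast (Real.log_ne_zero_of_pos_of_ne_one hq hq1)
  rw [funext_iff]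
  refine forall_congr' fun b => ?_
  have hb : (qAt m n q b : ℂ) ≠ 0 := by exact_mod_cast (qAt_pos hq b).ne'
  rw [Complex.cpow_def_of_ne_zero hb, Complex.cpow_def_of_ne_zero hb,
    Complex.exp_eq_exp_iff_exists_int, ← Complex.ofReal_log (qAt_pos hq b).le]
  rcases log_qAt (m := m) (n := n) (q := q) b with h | h <;> rw [h]
  · refine exists_congr fun k => ?_
    field_simp
  · refine ⟨fun ⟨k, hk⟩ => ⟨-k, ?_⟩, fun ⟨k, hk⟩ => ⟨-k, ?_⟩⟩
    · rw [hk]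
      push_cast
      field_simp
      ring
    · push_cast at hk ⊢
      field_simp
      linear_combination -hk

end Weights

/-! ### Parabolic subalgebras and their modules -/

section Parabolic

variable {m n : ℕ} {q : ℝ}

open Classical in
/-- The generator `g`, as an element of a subalgebra that contains it (and `0` for a subalgebra that
does not). -/
noncomputable def subGen (B : Subalgebra ℂ (Uq m n q)) (g : Gen m n) : B :=
  if h : gen g ∈ B then ⟨gen g, h⟩ else 0

theorem subGen_of_mem {B : Subalgebra ℂ (Uq m n q)} {g : Gen m n} (h : gen g ∈ B) :
    subGen B g = ⟨gen g, h⟩ := dif_pos h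

theorem coe_subGen {B : Subalgebra ℂ (Uq m n q)} {g : Gen m n} (h : gen g ∈ B) :
    (subGen B g : Uq m n q) = gen g := by
  rw [subGen_of_mem h]

theorem subGen_mem_subParity {B : Subalgebra ℂ (Uq m n q)} {g : Gen m n} (h : gen g ∈ B) :
    subGen B g ∈ subParity B g.parity := by
  change (subGen B g : Uq m n q) ∈ parityPart m n q g.parity
  rw [coe_subGen h]
  exact gen_mem_parityPart g

theorem adjoin_subGen_eq_top {X : Set (Uq m n q)} {Y : Set (Algebra.adjoin ℂ X)}
    (h : ∀ x ∈ X, ∃ g, x = gen g ∧ subGen (Algebra.adjoin ℂ X) g ∈ Y) :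
    Algebra.adjoin ℂ Y = ⊤ := by
  rw [eq_top_iff, ← Algebra.adjoin_adjoin_coe_preimage (R := ℂ) (s := X)]
  refine Algebra.adjoin_mono ?_
  rintro ⟨x, hxX⟩ hx
  obtain ⟨g, rfl, hg⟩ := h x hx
  rwa [subGen_of_mem hxX] at hg

/-- The parabolic subalgebra with the root vectors `rootGen b i` for all nodes, and `rootGen (!b) i`
for the nodes `i ∈ Θ` only. -/
def parabolic (q : ℝ) (Θ : Set (Fin (m + n - 1))) (b : Bool) : Subalgebra ℂ (Uq m n q) :=
  Algebra.adjoin ℂ (leviGens q Θ ∪ {x | ∃ c ∉ Θ, x = gen (rootGen b c)})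

variable (q) (Θ : Set (Fin (m + n - 1)))

theorem rootGen_mem_levi (b : Bool) {i : Fin (m + n - 1)} (hi : i ∈ Θ) :
    gen (rootGen b i) ∈ levi q Θ := by
  cases b
  · exact F_mem_levi q Θ hi
  · exact E_mem_levi q Θ hi

theorem Kinv_mem_levi (a : Fin (m + n)) : gen (.Kinv a) ∈ levi q Θ :=
  Algebra.subset_adjoin (Or.inr (Or.inl ⟨a, rfl⟩))

theorem levi_le_parabolic (b : Bool) : levi q Θ ≤ parabolic q Θ b :=
  Algebra.adjoin_mono Set.subset_union_left

theorem rootGen_mem_parabolic (b : Bool) (i : Fin (m + n - 1)) :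
    gen (rootGen b i) ∈ parabolic q Θ b := by
  by_cases hi : i ∈ Θ
  · exact levi_le_parabolic q Θ b (rootGen_mem_levi q Θ b hi)
  · exact Algebra.subset_adjoin (Or.inr ⟨i, hi, rfl⟩)

theorem exists_gen_of_mem_leviGens (b : Bool) {x : Uq m n q} (hx : x ∈ leviGens q Θ) :
    (∃ a, x = gen (.K a)) ∨ (∃ a, x = gen (.Kinv a)) ∨ (∃ c ∈ Θ, x = gen (rootGen (!b) c)) ∨
      ∃ c ∈ Θ, x = gen (rootGen b c) := by
  rcases hx with h | h | h | h
  · exact Or.inl h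
  · exact Or.inr (Or.inl h)
  · cases b
    · exact Or.inr (Or.inr (Or.inl h))
    · exact Or.inr (Or.inr (Or.inr h))
  · cases b
    · exact Or.inr (Or.inr (Or.inr h))
    · exact Or.inr (Or.inr (Or.inl h))

theorem adjoin_subGen_parabolic (b : Bool) :
    Algebra.adjoin ℂ (Set.range (fun a => subGen (parabolic q Θ b) (.K a)) ∪
      Set.range (fun a => subGen (parabolic q Θ b) (.Kinv a)) ∪
      (fun i => subGen (parabolic q Θ b) (rootGen (!b) i)) '' Θ ∪
      Set.range fun i => subGen (parabolic q Θ b) (rootGen b i)) = ⊤ := by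
  refine adjoin_subGen_eq_top fun x hx => ?_
  rcases hx with hx | ⟨c, -, rfl⟩
  · rcases exists_gen_of_mem_leviGens q Θ b hx with
      ⟨a, rfl⟩ | ⟨a, rfl⟩ | ⟨c, hc, rfl⟩ | ⟨c, hc, rfl⟩
    · exact ⟨_, rfl, Or.inl (Or.inl (Or.inl ⟨a, rfl⟩))⟩
    · exact ⟨_, rfl, Or.inl (Or.inl (Or.inr ⟨a, rfl⟩))⟩
    · exact ⟨_, rfl, Or.inl (Or.inr ⟨c, hc, rfl⟩)⟩
    · exact ⟨_, rfl, Or.inr ⟨c, rfl⟩⟩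
  · exact ⟨_, rfl, Or.inr ⟨c, rfl⟩⟩

theorem adjoin_subGen_levi (b : Bool) :
    Algebra.adjoin ℂ (Set.range (fun a => subGen (levi q Θ) (.K a)) ∪
      Set.range (fun a => subGen (levi q Θ) (.Kinv a)) ∪
      (fun i => subGen (levi q Θ) (rootGen (!b) i)) '' Θ ∪
      (fun i => subGen (levi q Θ) (rootGen b i)) '' Θ) = ⊤ := by
  refine adjoin_subGen_eq_top fun x hx => ?_
  rcases exists_gen_of_mem_leviGens q Θ b hx with ⟨a, rfl⟩ | ⟨a, rfl⟩ | ⟨c, hc, rfl⟩ | ⟨c, hc, rfl⟩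
  · exact ⟨_, rfl, Or.inl (Or.inl (Or.inl ⟨a, rfl⟩))⟩
  · exact ⟨_, rfl, Or.inl (Or.inl (Or.inr ⟨a, rfl⟩))⟩
  · exact ⟨_, rfl, Or.inl (Or.inr ⟨c, hc, rfl⟩)⟩
  · exact ⟨_, rfl, Or.inr ⟨c, hc, rfl⟩⟩

variable {q Θ}

theorem adjoin_gen_eq_top (b : Bool) :
    Algebra.adjoin ℂ (Set.range (fun a => (gen (.K a) : Uq m n q)) ∪
      Set.range (fun a => gen (.Kinv a)) ∪ (fun i => gen (rootGen (!b) i)) '' Set.univ ∪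
      (fun i => gen (rootGen b i)) '' Set.univ) = ⊤ := by
  rw [eq_top_iff, ← adjoin_range_gen]
  refine Algebra.adjoin_mono ?_
  rintro _ ⟨g, rfl⟩
  cases g with
  | K a => exact Or.inl (Or.inl (Or.inl ⟨a, rfl⟩))
  | Kinv a => exact Or.inl (Or.inl (Or.inr ⟨a, rfl⟩))
  | E i =>
    cases b
    · exact Or.inl (Or.inr ⟨i, trivial, rfl⟩)
    · exact Or.inr ⟨i, trivial, rfl⟩
  | F i =>
    cases b
    · exact Or.inr ⟨i, trivial, rfl⟩
    · exact Or.inl (Or.inr ⟨i, trivial, rfl⟩)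

theorem subGen_K_mul_Kinv {B : Subalgebra ℂ (Uq m n q)} (hB : levi q Θ ≤ B) (a : Fin (m + n)) :
    subGen B (.K a) * subGen B (.Kinv a) = 1 := by
  refine Subtype.ext ?_
  simp [coe_subGen (hB (K_mem_levi q Θ a)), coe_subGen (hB (Kinv_mem_levi q Θ a)), gen_K_mul_Kinv]

theorem subGen_Kinv_mul_K {B : Subalgebra ℂ (Uq m n q)} (hB : levi q Θ ≤ B) (a : Fin (m + n)) :
    subGen B (.Kinv a) * subGen B (.K a) = 1 := by
  refine Subtype.ext ?_
  simp [coe_subGen (hB (K_mem_levi q Θ a)), coe_subGen (hB (Kinv_mem_levi q Θ a)), gen_Kinv_mul_K]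

variable {W V : Type*} [AddCommGroup W] [Module ℂ W] [AddCommGroup V] [Module ℂ V]

/-- An irreducible `U_q(gl(m|n))`-module is generated by a homogeneous vector killed by the
`rootGen (!b) i` under the `rootGen b i`. -/
theorem lowerSpan_eq_top_of_isIrreducible [FiniteDimensional ℂ W] (b : Bool)
    {𝒲 : ZMod 2 → Submodule ℂ W} {ρ : Uq m n q →ₐ[ℂ] Module.End ℂ W}
    (hW : IsIrreducibleSuperModule (parityPart m n q) 𝒲 ρ) {χ : Fin (m + n) → ℂ} {v : W}
    (hv : IsHighest Set.univ (fun a => ρ (gen (.K a))) (fun i => ρ (gen (rootGen (!b) i))) χ v)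
    (hv0 : v ≠ 0) : ∃ i, ∃ u ∈ 𝒲 i, u ≠ 0 ∧
      IsHighest Set.univ (fun a => ρ (gen (.K a))) (fun i => ρ (gen (rootGen (!b) i))) χ u ∧
      lowerSpan (fun i => ρ (gen (rootGen b i))) u = ⊤ := by
  have htri := isTriangular_of_relations (Θ := Set.univ) (K := fun a => (gen (.K a) : Uq m n q))
    (E := fun i => gen (rootGen (!b) i)) (F := fun i => gen (rootGen b i)) gen_Kinv_mul_K
    gen_K_mul_K (gen_K_mul_rootGen b)
    (fun i _ j => by simpa using gen_rootGen_mul_rootGen (q := q) (!b) i j) ρ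
  have hmem : ∀ (g : Gen m n) (j : ZMod 2), ∀ w ∈ 𝒲 j, ρ (gen g) w ∈ 𝒲 (g.parity + j) :=
    fun g j w hw => hW.map_mem _ j _ w (gen_mem_parityPart g) hw
  have hsuper : IsSuperTriangular 𝒲 nodeParity Set.univ _ _ _ _ _ _ :=
    { htri with
      isInternal := hW.isInternal
      k_mem := fun a j w hw => by simpa [Gen.parity] using hmem (.K a) j w hw
      e_mem := fun i _ j w hw => by
        simpa only [parity_rootGen] using hmem (rootGen (!b) i) j w hw
      f_mem := fun i j w hw => by
        simpa only [parity_rootGen] using hmem (rootGen b i) j w hw }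
  have hirr : IsSuperIrred 𝒲 Set.univ (fun a => ρ (gen (.K a)))
      (fun i => ρ (gen (rootGen (!b) i))) (fun i => ρ (gen (rootGen b i))) :=
    fun N hN hk he hf => hW.eq_bot_or_eq_top N hN
      (mem_of_stable_generators gen_Kinv_mul_K (adjoin_gen_eq_top b) ρ hk he hf)
  obtain ⟨i, u, hui, hu0, hu⟩ := hsuper.exists_homogeneous_highest hv hv0
  exact ⟨i, u, hui, hu0, hu, hsuper.lowerSpan_eq_top_of_irred hirr hui hu hu0⟩

theorem isTriangular_parabolic (b : Bool) (τ : parabolic q Θ b →ₐ[ℂ] Module.End ℂ V) :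
    IsTriangular Θ (fun a j => (qAt m n q a : ℂ) ^ (rootSign b * rootCoeff a j))
      (fun i j => sgn (nodeParity i * nodeParity j))
      (fun i j χ => if i = j then commCoeff m n q (!b) i *
        (χ (lft i) * (χ (rgt i))⁻¹ - (χ (lft i))⁻¹ * χ (rgt i)) else 0)
      (fun a => τ (subGen _ (.K a))) (fun i => τ (subGen _ (rootGen (!b) i)))
      (fun i => τ (subGen _ (rootGen b i))) := by
  have hle := levi_le_parabolic q Θ b
  have hK := fun a => coe_subGen (hle (K_mem_levi q Θ a))
  have hKi := fun a => coe_subGen (hle (Kinv_mem_levi q Θ a))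
  have hF := fun i => coe_subGen (rootGen_mem_parabolic q Θ b i)
  have hE := fun i (hi : i ∈ Θ) => coe_subGen (hle (rootGen_mem_levi q Θ (!b) hi))
  refine isTriangular_of_relations (K := fun a => subGen _ (.K a))
    (Ki := fun a => subGen _ (.Kinv a)) (E := fun i => subGen _ (rootGen (!b) i))
    (F := fun i => subGen _ (rootGen b i)) (subGen_Kinv_mul_K hle)
    (fun a a' => Subtype.ext ?_) (fun a j => Subtype.ext ?_) (fun i hi j => Subtype.ext ?_) τ
  · simp [hK, gen_K_mul_K a a']
  · simpa [hK, hF] using gen_K_mul_rootGen b a j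
  · have h := gen_rootGen_mul_rootGen (q := q) (!b) i j
    rw [Bool.not_not] at h
    split_ifs at h ⊢ <;> simpa [hK, hKi, hF, hE i hi] using h

theorem isSuperIrred_levi [FiniteDimensional ℂ V] (b : Bool) {𝒱 : ZMod 2 → Submodule ℂ V}
    {σ : levi q Θ →ₐ[ℂ] Module.End ℂ V}
    (hV : IsIrreducibleSuperModule (subParity (levi q Θ)) 𝒱 σ) :
    IsSuperIrred 𝒱 Θ (fun a => σ (subGen _ (.K a))) (fun i => σ (subGen _ (rootGen (!b) i)))
      (fun i => σ (subGen _ (rootGen b i))) :=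
  fun N hN hk he hf => hV.eq_bot_or_eq_top N hN
    (mem_of_stable_generators (K := fun a => subGen _ (.K a)) (Ki := fun a => subGen _ (.Kinv a))
      (E := fun i => subGen _ (rootGen (!b) i)) (F := fun i => subGen _ (rootGen b i))
      (subGen_Kinv_mul_K le_rfl) (adjoin_subGen_levi q Θ b) σ hk he hf)

/-- The Hom spaces for both kinds of parabolic subalgebra. Highest vectors in the sense of
`IsHighest` are those killed by the `rootGen (!b) i`: for `b = false` these are the highest weight
vectors, for `b = true` the lowest weight vectors. -/
theorem finrank_superHom_parabolic [FiniteDimensional ℂ W] [FiniteDimensional ℂ V] (hq : 0 < q)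
    (hq1 : q ≠ 1) (b : Bool) {𝒲 : ZMod 2 → Submodule ℂ W} {ρ : Uq m n q →ₐ[ℂ] Module.End ℂ W}
    (hW : IsIrreducibleSuperModule (parityPart m n q) 𝒲 ρ) {𝒱 : ZMod 2 → Submodule ℂ V}
    {σ : levi q Θ →ₐ[ℂ] Module.End ℂ V}
    (hV : IsIrreducibleSuperModule (subParity (levi q Θ)) 𝒱 σ)
    {τ : parabolic q Θ b →ₐ[ℂ] Module.End ℂ V}
    (hτ : τ.comp (Subalgebra.inclusion (levi_le_parabolic q Θ b)) = σ)
    (hτ0 : ∀ i ∉ Θ, τ (subGen _ (rootGen b i)) = 0) {lam mu : Fin (m + n) → ℂ} {v : W}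
    (hv0 : v ≠ 0)
    (hv : IsHighest Set.univ (fun a => ρ (gen (.K a))) (fun i => ρ (gen (rootGen (!b) i)))
      (fun a => (qAt m n q a : ℂ) ^ lam a) v)
    {u : V} (hu0 : u ≠ 0)
    (hu : IsHighest Θ (fun a => σ (subGen _ (.K a))) (fun i => σ (subGen _ (rootGen (!b) i)))
      (fun a => (qAt m n q a : ℂ) ^ mu a) u) :
    (SameWeight q lam mu → Module.finrank ℂ
        (superHom (subParity (parabolic q Θ b)) 𝒲 𝒱 (ρ.comp (parabolic q Θ b).val) τ) = 1) ∧
      (¬ SameWeight q lam mu → Module.finrank ℂ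
        (superHom (subParity (parabolic q Θ b)) 𝒲 𝒱 (ρ.comp (parabolic q Θ b).val) τ) = 0) := by
  have hle := levi_le_parabolic q Θ b
  have hK := fun a => coe_subGen (hle (K_mem_levi q Θ a))
  have hF := fun i => coe_subGen (rootGen_mem_parabolic q Θ b i)
  have hE := fun i (hi : i ∈ Θ) => coe_subGen (hle (rootGen_mem_levi q Θ (!b) hi))
  have hστ : ∀ g, gen g ∈ levi q Θ → τ (subGen _ g) = σ (subGen _ g) := fun g hg => by
    rw [subGen_of_mem (hle hg), subGen_of_mem hg, ← hτ]
    rfl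
  have hστK := fun a => hστ _ (K_mem_levi q Θ a)
  have hστR := fun b' i (hi : i ∈ Θ) => hστ _ (rootGen_mem_levi q Θ b' hi)
  have hmem : ∀ (g : Gen m n), gen g ∈ levi q Θ → ∀ j, ∀ w ∈ 𝒱 j,
      σ (subGen _ g) w ∈ 𝒱 (g.parity + j) :=
    fun g hg j w hw => hV.map_mem _ j _ w (subGen_mem_subParity hg) hw
  have hVtri : IsSuperTriangular 𝒱 nodeParity Θ _ _ _ _ _ _ :=
    { isTriangular_parabolic b τ with
      isInternal := hV.isInternal
      k_mem := fun a j w hw => by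
        simpa only [hστK, Gen.parity, zero_add] using hmem _ (K_mem_levi q Θ a) j w hw
      e_mem := fun i hi j w hw => by
        simpa only [hστR (!b) i hi, parity_rootGen] using
          hmem _ (rootGen_mem_levi q Θ (!b) hi) j w hw
      f_mem := fun i j w hw => by
        by_cases hi : i ∈ Θ
        · simpa only [hστR b i hi, parity_rootGen] using
            hmem _ (rootGen_mem_levi q Θ b hi) j w hw
        · simp [hτ0 i hi] }
  have hirr : IsSuperIrred 𝒱 Θ (fun a => τ (subGen _ (.K a)))
      (fun i => τ (subGen _ (rootGen (!b) i))) (fun i => τ (subGen _ (rootGen b i))) := by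
    refine fun N hN hk he hf => isSuperIrred_levi b hV N hN (fun a w hw => ?_)
      (fun i hi w hw => ?_) fun i hi w hw => ?_
    · simpa only [hστK] using hk a w hw
    · simpa only [hστR (!b) i hi] using he i hi w hw
    · simpa only [hστR b i hi] using hf i hi w hw
  obtain ⟨i, v', hvi, hv0', hv', hvt⟩ := lowerSpan_eq_top_of_isIrreducible b hW hv hv0
  have hWs : IsSuperModule (subParity (parabolic q Θ b)) 𝒲 (ρ.comp (parabolic q Θ b).val) :=
    ⟨hW.isInternal, fun i j a w ha hw => hW.map_mem i j _ w ha hw⟩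
  have hne : ∀ (lam : Fin (m + n) → ℂ) (a : Fin (m + n)), (qAt m n q a : ℂ) ^ lam a ≠ 0 :=
    fun lam a h => (qAt_pos hq a).ne' (by exact_mod_cast (Complex.cpow_eq_zero_iff _ _).1 h |>.1)
  rw [sameWeight_iff hq hq1]
  refine finrank_superHom (K := fun a => subGen _ (.K a)) (Ki := fun a => subGen _ (.Kinv a))
    (E := fun i => subGen _ (rootGen (!b) i)) (F := fun i => subGen _ (rootGen b i))
    (p := nodeParity) (subGen_K_mul_Kinv hle) (subGen_Kinv_mul_K hle)
    (adjoin_subGen_parabolic q Θ b) (fun a => subGen_mem_subParity (hle (K_mem_levi q Θ a)))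
    (fun i hi => ?_) (fun i => ?_) (eq_nil_of_weight_eq_one hq hq1 b) hWs
    (isTriangular_parabolic b _) hVtri hirr (hne lam) (hne mu) hvi hv0' ?_ ?_ hu0 ?_
  · rw [← parity_rootGen (!b)]
    exact subGen_mem_subParity (hle (rootGen_mem_levi q Θ (!b) hi))
  · rw [← parity_rootGen b]
    exact subGen_mem_subParity (rootGen_mem_parabolic q Θ b i)
  · refine ⟨fun a => ?_, fun i hi => ?_⟩
    · simpa [hK] using hv'.k_eq a
    · simpa [hE i hi] using hv'.e_eq i trivial
  · simpa [hF] using hvt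
  · refine ⟨fun a => ?_, fun i hi => ?_⟩
    · simpa only [hστK] using hu.k_eq a
    · simpa only [hστR (!b) i hi] using hu.e_eq i hi

end Parabolic

end QuantumGL

theorem mainTheorem7 (m n : ℕ) (q : ℝ) (hq : 0 < q) (hq1 : q ≠ 1)
    (Θ : Set (Fin (m + n - 1)))
    {W : Type*} [AddCommGroup W] [Module ℂ W] [FiniteDimensional ℂ W]
    (𝒲 : ZMod 2 → Submodule ℂ W) (ρ : QuantumGL.Uq m n q →ₐ[ℂ] Module.End ℂ W)
    (hW : QuantumGL.IsIrreducibleSuperModule (QuantumGL.parityPart m n q) 𝒲 ρ)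
    (lam lamBar : Fin (m + n) → ℂ)
    (hlam : QuantumGL.IsHighestWeight ρ lam) (hlamBar : QuantumGL.IsLowestWeight ρ lamBar)
    {V : Type*} [AddCommGroup V] [Module ℂ V] [FiniteDimensional ℂ V]
    (𝒱 : ZMod 2 → Submodule ℂ V) (σ : QuantumGL.levi q Θ →ₐ[ℂ] Module.End ℂ V)
    (hV : QuantumGL.IsIrreducibleSuperModule
      (QuantumGL.subParity (QuantumGL.levi q Θ)) 𝒱 σ)
    (mu muTilde : Fin (m + n) → ℂ)
    (hmu : QuantumGL.IsLeviHighestWeight Θ σ mu)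
    (hmuTilde : QuantumGL.IsLeviLowestWeight Θ σ muTilde) :
    (∀ τ : QuantumGL.parabolicPos q Θ →ₐ[ℂ] Module.End ℂ V,
      QuantumGL.IsPosExtension Θ σ τ →
        (QuantumGL.SameWeight q lamBar muTilde →
          Module.finrank ℂ (QuantumGL.superHom
            (QuantumGL.subParity (QuantumGL.parabolicPos q Θ)) 𝒲 𝒱
            (ρ.comp (QuantumGL.parabolicPos q Θ).val) τ) = 1) ∧
        (¬ QuantumGL.SameWeight q lamBar muTilde →
          Module.finrank ℂ (QuantumGL.superHom
            (QuantumGL.subParity (QuantumGL.parabolicPos q Θ)) 𝒲 𝒱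
            (ρ.comp (QuantumGL.parabolicPos q Θ).val) τ) = 0)) ∧
    (∀ τ : QuantumGL.parabolicNeg q Θ →ₐ[ℂ] Module.End ℂ V,
      QuantumGL.IsNegExtension Θ σ τ →
        (QuantumGL.SameWeight q lam mu →
          Module.finrank ℂ (QuantumGL.superHom
            (QuantumGL.subParity (QuantumGL.parabolicNeg q Θ)) 𝒲 𝒱
            (ρ.comp (QuantumGL.parabolicNeg q Θ).val) τ) = 1) ∧
        (¬ QuantumGL.SameWeight q lam mu →
          Module.finrank ℂ (QuantumGL.superHom
            (QuantumGL.subParity (QuantumGL.parabolicNeg q Θ)) 𝒲 𝒱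
            (ρ.comp (QuantumGL.parabolicNeg q Θ).val) τ) = 0)) := by
  obtain ⟨v, hv0, hvE, hvK⟩ := hlam
  obtain ⟨v', hv0', hvF, hvK'⟩ := hlamBar
  obtain ⟨u, hu0, huE, huK⟩ := hmu
  obtain ⟨u', hu0', huF, huK'⟩ := hmuTilde
  constructor
  · rintro τ ⟨hτ, hτ0⟩
    refine QuantumGL.finrank_superHom_parabolic hq hq1 true hW hV hτ (fun i hi => ?_) hv0'
      ⟨hvK', fun i _ => hvF i⟩ hu0' ⟨fun a => ?_, fun i hi => ?_⟩
    · rw [QuantumGL.subGen_of_mem (QuantumGL.rootGen_mem_parabolic q Θ true i)]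
      exact hτ0 i hi
    · rw [QuantumGL.subGen_of_mem (QuantumGL.K_mem_levi q Θ a)]
      exact huK' a
    · rw [QuantumGL.subGen_of_mem (QuantumGL.rootGen_mem_levi q Θ (!true) hi)]
      exact huF i hi
  · rintro τ ⟨hτ, hτ0⟩
    refine QuantumGL.finrank_superHom_parabolic hq hq1 false hW hV hτ (fun i hi => ?_) hv0
      ⟨hvK, fun i _ => hvE i⟩ hu0 ⟨fun a => ?_, fun i hi => ?_⟩
    · rw [QuantumGL.subGen_of_mem (QuantumGL.rootGen_mem_parabolic q Θ false i)]
      exact hτ0 i hi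
    · rw [QuantumGL.subGen_of_mem (QuantumGL.K_mem_levi q Θ a)]
      exact huK a
    · rw [QuantumGL.subGen_of_mem (QuantumGL.rootGen_mem_levi q Θ (!false) hi)]
      exact huE i hi
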